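/- **Setting.** Let $d\ge 1$ and let $f:\mathbb R^d\to[0,\infty)$ be continuous with $f(x)=0\iff x=0$ and $f(\lambda x)=\lambda f(x)$ for all $\lambda\ge 0$, $x\in\mathbb R^d$. Put $x\vee_f y:=x$ if $f(x)\ge f(y)$ and $x\vee_f y:=y$ if $f(x)<f(y)$, and inductively $\bigvee_{f,\,j=1}^{k}x_j:=\big(\bigvee_{f,\,j=1}^{k-1}x_j\big)\vee_f x_k$; infinite $\vee_f$-maxima are limits of the finite ones. Let $\alpha>0$, let $\kappa$ be a Borel probability measure on $S=\{f=1\}$, let $(E,\mathcal E,m)$ be a $\sigma$-finite measure space, $\mathcal E_0=\{A\in\mathcal E: m(A)<\infty\}$, and let $(\Omega,\mathcal A,\mathbb P)$ be a probability space. For $\sigma\ge 0$, $\Phi^f_{\alpha,\kappa}(\sigma)$ denotes the law of $\sigma Z\Theta$, where $Z$ and $\Theta$ are independent, $\mathbb P(Z\le x)=e^{-x^{-\alpha}}$ for $x>0$ and $=0$ for $x\le 0$, and $\Theta\sim\kappa$. An *$f$-implicit $\alpha$-Fréchet sup-measure* (with control measure $m$ and angular part $\kappa$) is a map $M$ assigning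 to each $A\in\mathcal E_0$ an $\mathbb R^d$-valued random vector $M(A)$ on $\Omega$ such that: (1) $M(A_1),\dots,M(A_k)$ are independent for disjoint $A_1,\dots,A_k\in\mathcal E_0$; (2) for disjoint $A_1,A_2,\dots\in\mathcal E_0$ with $\bigcup_jA_j\in\mathcal E_0$, almost surely $M(\bigcup_jA_j)=\bigvee_{f,\,j=1}^{\infty}M(A_j)=M(A_{j_0})$ for a random index $j_0$; (3) $M(A)\sim\Phi^f_{\alpha,\kappa}(m(A)^{1/\alpha})$ for all $A\in\mathcal E_0$. For a simple function $g=\sum_{j=1}^k\alpha_j\mathbf 1_{A_j}$ ($k\ge1$, $\alpha_j\ge 0$, $A_j\in\mathcal E_0$ disjoint) put $I(g):=\bigvee_{f,\,j=1}^k\alpha_jM(A_j)$. Let $L^\alpha_+(m)$ be the set of measurable $g:E\to[0,\infty)$ with $\|g\|_\alpha:=(\int_E g^\alpha\,dm)^{1/\alpha}<\infty$. For $g\in L^\alpha_+(m)$ let $I(g)=\int_E^{\vee_f}g\,dM$ be the limit in probability of $I(g_n)$, where $(g_n)$ is a sequence of simple functions increasing pointwise to $g$. A random vector $Y$ is *$f$-implicit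 max-stable* if for every $k\ge 1$ there is $b_k>0$ such that $b_k^{-1}\bigvee_{f,\,j=1}^kY_j$ has the law of $Y$ whenever $Y_1,\dots,Y_k$ are i.i.d. copies of $Y$. An $\mathbb R^d$-valued process $(X(t))_{t\in I}$ is *$f$-implicit max-stable* if $\bigvee_{f,\,j=1}^k a_jX(t_j)$ is $f$-implicit max-stable for all $k\ge1$, $a_1,\dots,a_k\ge 0$ and $t_1,\dots,t_k\in I$. **Proposition.** Let $M$ be an $f$-implicit $\alpha$-Fréchet sup-measure as above. The integral is well defined on $L^\alpha_+(m)$: for every $g\in L^\alpha_+(m)$ there is a sequence of simple functions increasing pointwise to $g$, and there is a random vector $I(g)$ to which $I(g_n)$ converges in probability for every such sequence $(g_n)$. Let $I\ne\emptyset$ be an index set, $(g_t)_{t\in I}\subset L^\alpha_+(m)$ and $X(t):=I(g_t)$. Then the process $(X(t))_{t\in I}$ is $f$-implicit max-stable. More precisely, for all $k\ge 1$, $a_1,\dots,a_k\ge 0$ and $t_1,\dots,t_k\in I$, the function $\bigvee_{j=1}^ka_jg_{t_j}$ (pointwise maximum) lies in $L^\alpha_+(m)$, and almost surely $$\bigvee_{f,\,j=1}^{k}a_jX(t_j)=\int_E^{\vee_f}\Big(\bigvee_{j=1}^ka_jg_{t_j}(s)\Big)\,dM(s)\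 \sim\ \Phi^f_{\alpha,\kappa}\Big(\big\|\textstyle\bigvee_{j=1}^ka_jg_{t_j}\big\|_\alpha\Big).$$ -/

import Mathlib

open MeasureTheory ProbabilityTheory Filter Topology
open scoped NNReal ENNReal

namespace ImplicitExtremal

/-- The space `ℝ^d` with its Euclidean norm. -/
abbrev Vec (d : ℕ) := EuclideanSpace ℝ (Fin d)

/-- Loss functions `f : ℝ^d → [0, ∞)`: continuous, vanishing exactly at the origin,
and `1`-homogeneous. -/
structure IsLossFunction {d : ℕ} (f : Vec d → ℝ) : Prop where
  nonneg : ∀ x, 0 ≤ f x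
  continuous : Continuous f
  eq_zero_iff : ∀ x, f x = 0 ↔ x = 0
  homogeneous : ∀ (c : ℝ) (x : Vec d), 0 ≤ c → f (c • x) = c * f x

open Classical in
/-- The operation `x ∨_f y`: the argument with the larger loss; ties go to the first one. -/
noncomputable def fJoin {d : ℕ} (f : Vec d → ℝ) (x y : Vec d) : Vec d :=
  if f y ≤ f x then x else y

/-- The iterated operation `x_0 ∨_f ⋯ ∨_f x_k = (x_0 ∨_f ⋯ ∨_f x_{k-1}) ∨_f x_k`
of the `k + 1` vectors `x_0, …, x_k`. -/
noncomputable def fMax {d : ℕ} (f : Vec d → ℝ) : (k : ℕ) → (Fin (k + 1) → Vec d) → Vec d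
  | 0, x => x 0
  | k + 1, x => fJoin f (fMax f k (fun j => x j.castSucc)) (x (Fin.last (k + 1)))

/-- A random vector `Y` is `f`-implicit max-stable: for every `k ≥ 1` (written `k + 1` below)
there is `b > 0` such that `b⁻¹ (Y_1 ∨_f ⋯ ∨_f Y_k)` has the law of `Y` when `Y_1, …, Y_k`
are i.i.d. copies of `Y` (realised as the coordinates of the product of `k` copies of
the law of `Y`). -/
def IsImplicitMaxStable {d : ℕ} (f : Vec d → ℝ) {Ω : Type*} [MeasurableSpace Ω]
    (P : Measure Ω) (Y : Ω → Vec d) : Prop :=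
  Measurable Y ∧ ∀ k : ℕ, ∃ b : ℝ, 0 < b ∧
    (Measure.pi (fun _ : Fin (k + 1) => P.map Y)).map (fun y => b⁻¹ • fMax f k y) = P.map Y

/-- An `ℝ^d`-valued process is `f`-implicit max-stable if all
`a_0 X(t_0) ∨_f ⋯ ∨_f a_k X(t_k)` with nonnegative `a_j` are `f`-implicit max-stable. -/
def IsImplicitMaxStableProcess {d : ℕ} (f : Vec d → ℝ) {Ω : Type*} [MeasurableSpace Ω]
    (P : Measure Ω) {ι : Type*} (X : ι → Ω → Vec d) : Prop :=
  (∀ t, Measurable (X t)) ∧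
  ∀ (k : ℕ) (a : Fin (k + 1) → ℝ≥0) (t : Fin (k + 1) → ι),
    IsImplicitMaxStable f P (fun ω => fMax f k (fun j => (a j : ℝ) • X (t j) ω))

/-- `ν` is the standard `α`-Fréchet law on `ℝ`, given by its distribution function. -/
def IsStandardFrechet (α : ℝ) (ν : Measure ℝ) : Prop :=
  IsProbabilityMeasure ν ∧
    (∀ x : ℝ, 0 < x → ν (Set.Iic x) = ENNReal.ofReal (Real.exp (-(x ^ (-α))))) ∧
    (∀ x : ℝ, x ≤ 0 → ν (Set.Iic x) = 0)

/-- `Y ∼ Φ^f_{α,κ}(σ)`: the law of `Y` is that of `σ Z Θ`, with `Z` standard `α`-Fréchet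
and independent of the `κ`-distributed vector `Θ` in the unit sphere `S = {f = 1}`. -/
def HasImplicitFrechetLaw {d : ℕ} (f : Vec d → ℝ) (α : ℝ) (κ : Measure {x : Vec d // f x = 1})
    (σ : ℝ) {Ω : Type*} [MeasurableSpace Ω] (P : Measure Ω) (Y : Ω → Vec d) : Prop :=
  ∃ ν : Measure ℝ, IsStandardFrechet α ν ∧
    P.map Y = (ν.prod κ).map (fun p => (σ * p.1) • (p.2 : Vec d))

/-- `f`-implicit sup-measures `M`, defined on the measurable sets of finite `m`-measure
(the values of `M` at other sets are irrelevant and never used).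
In `sup`, the infinite `∨_f`-maximum is the limit of the finite ones. -/
structure IsImplicitSupMeasure {d : ℕ} (f : Vec d → ℝ) {E Ω : Type*} [MeasurableSpace E]
    [MeasurableSpace Ω] (m : Measure E) (P : Measure Ω) (M : Set E → Ω → Vec d) : Prop where
  measurable : ∀ A, MeasurableSet A → m A < ∞ → Measurable (M A)
  indep : ∀ (k : ℕ) (A : Fin k → Set E), (∀ j, MeasurableSet (A j)) → (∀ j, m (A j) < ∞) →
    Pairwise (fun i j => Disjoint (A i) (A j)) → iIndepFun (fun j => M (A j)) P
  sup : ∀ A : ℕ → Set E, (∀ j, MeasurableSet (A j)) → (∀ j, m (A j) < ∞) →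
    Pairwise (fun i j => Disjoint (A i) (A j)) → m (⋃ j, A j) < ∞ →
    ∀ᵐ ω ∂P,
      Tendsto (fun n : ℕ => fMax f n (fun j => M (A j) ω)) atTop (𝓝 (M (⋃ j, A j) ω)) ∧
      ∃ j₀ : ℕ, M (⋃ j, A j) ω = M (A j₀) ω

/-- `f`-implicit `α`-Fréchet sup-measures with control measure `m` and angular part `κ`:
`M A ∼ Φ^f_{α,κ}(m(A)^{1/α})`. -/
structure IsImplicitFrechetSupMeasure {d : ℕ} (f : Vec d → ℝ) (α : ℝ)
    (κ : Measure {x : Vec d // f x = 1}) {E Ω : Type*} [MeasurableSpace E]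
    [MeasurableSpace Ω] (m : Measure E) (P : Measure Ω) (M : Set E → Ω → Vec d) : Prop
    extends IsImplicitSupMeasure f m P M where
  law : ∀ A, MeasurableSet A → m A < ∞ →
    HasImplicitFrechetLaw f α κ ((m A).toReal ^ (1 / α)) P (M A)

/-- A representation `∑_{j=0}^k α_j 1_{A_j}` of a simple function, with `α_j ≥ 0` and disjoint
measurable sets `A_j` of finite measure. -/
structure SimpleRep {E : Type*} [MeasurableSpace E] (m : Measure E) where
  k : ℕ
  coef : Fin (k + 1) → ℝ≥0
  cell : Fin (k + 1) → Set E
  measurableSet_cell : ∀ j, MeasurableSet (cell j)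
  measure_cell_lt_top : ∀ j, m (cell j) < ∞
  disjoint_cell : Pairwise (fun i j => Disjoint (cell i) (cell j))

/-- The simple function given by a representation. -/
noncomputable def SimpleRep.toFun {E : Type*} [MeasurableSpace E] {m : Measure E}
    (r : SimpleRep m) (s : E) : ℝ≥0 :=
  ∑ j, (r.cell j).indicator (fun _ => r.coef j) s

/-- The integral of a simple function, `α_0 M(A_0) ∨_f ⋯ ∨_f α_k M(A_k)`. -/
noncomputable def SimpleRep.integral {d : ℕ} (f : Vec d → ℝ) {E Ω : Type*} [MeasurableSpace E]
    {m : Measure E} (M : Set E → Ω → Vec d) (r : SimpleRep m) (ω : Ω) : Vec d :=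
  fMax f r.k (fun j => (r.coef j : ℝ) • M (r.cell j) ω)

/-- `g_n ↑ g` pointwise on `E`, for a sequence of (represented) simple functions `g_n`. -/
def IncreasesTo {E : Type*} [MeasurableSpace E] {m : Measure E} (r : ℕ → SimpleRep m)
    (g : E → ℝ≥0) : Prop :=
  ∀ s, Monotone (fun n => (r n).toFun s) ∧ Tendsto (fun n => (r n).toFun s) atTop (𝓝 (g s))

/-- The random vector `Y` is an integral of `g` with respect to `M`: the limit in probability of
the integrals of some sequence of simple functions increasing to `g`. -/
def IsIntegral {d : ℕ} (f : Vec d → ℝ) {E Ω : Type*} [MeasurableSpace E] [MeasurableSpace Ω]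
    (m : Measure E) (P : Measure Ω) (M : Set E → Ω → Vec d) (g : E → ℝ≥0) (Y : Ω → Vec d) :
    Prop :=
  Measurable Y ∧ ∃ r : ℕ → SimpleRep m, IncreasesTo r g ∧
    TendstoInMeasure P (fun n => (r n).integral f M) atTop Y

open Classical in
/-- The `f`-implicit extremal integral `I(g)` (a version of it; `0` if `g` is not integrable). -/
noncomputable def integral {d : ℕ} (f : Vec d → ℝ) {E Ω : Type*} [MeasurableSpace E]
    [MeasurableSpace Ω] (m : Measure E) (P : Measure Ω) (M : Set E → Ω → Vec d)
    (g : E → ℝ≥0) : Ω → Vec d :=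
  if h : ∃ Y, IsIntegral f m P M g Y then h.choose else 0

/-- The class `L^α_+(m)` of measurable `g : E → [0, ∞)` with `∫ g^α dm < ∞`. -/
def MemLPlus {E : Type*} [MeasurableSpace E] (α : ℝ) (m : Measure E) (g : E → ℝ≥0) : Prop :=
  Measurable g ∧ ∫⁻ s, (g s : ℝ≥0∞) ^ α ∂m < ∞

/-- `‖g‖_α = (∫ g^α dm)^{1/α}`. -/
noncomputable def normLPlus {E : Type*} [MeasurableSpace E] (α : ℝ) (m : Measure E)
    (g : E → ℝ≥0) : ℝ :=
  (∫⁻ s, (g s : ℝ≥0∞) ^ α ∂m).toReal ^ (1 / α)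

end ImplicitExtremal

/-! A vector with law `Φ^f_{α,κ}(σ)` is a radius times an independent angle, and its loss is the
radius. In a `∨_f`-maximum of independent such vectors the radii alone choose the winner, the
winner's angle is again `κ`-distributed, and the scales add in `α`-th power
(`map_fMax_of_iIndepFun`). This gives the laws of integrals of simple functions, and max-stability
follows from the law.

The rest is pathwise. On a common refinement with cells `C_b`, the integral of a simple function
with values `u b` is a.s. the entry `u b • M(C_b)` of largest loss (`ae_isArgmax_integral`), and the
losses of the `M(C_b)` are independent Fréchet variables of scales `σ_b = m(C_b)^{1/α}`. Entry `b`
with weight `u b` beats all others with weights `w c ≥ u c` with probability at least `(u b σ_b)^α /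
∑ (w c σ_c)^α`. These events are disjoint, so a clear winner exists with probability at least `∑ (u
σ)^α / ∑ (w σ)^α` (`measure_not_clearWinner_le`). Three choices of weights carry the proof: - `u =
w`: ties are null, so the join of two simple integrals is the integral of the maximum
(`exists_integral_fJoin`). - `w` the values of `q`, and `u` those of `p ≤ q` set to zero where `p <
(1 - δ) q`: if the norms are close, both integrals come from the same cell and differ by a factor in
`[1 - δ, 1]`, up to small probability. With tightness this gives Cauchy sequences and independence
of the approximating sequence. - `w` the maximum of two simple functions and `u = (1 - δ) w`:
integrals with nearly equal losses are parallel up to small probability. In the limit, integrals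
with equal losses coincide a.s. (`ae_apply_ne_or_eq`), which lets the discontinuous operation `∨_f`
pass to the limit. -/

namespace ImplicitExtremal

/-! ### Exponential and Fréchet laws -/

/-- The standard `α`-Fréchet law, as the image of the exponential law under `t ↦ t ^ (-1 / α)`. -/
noncomputable def frechet (α : ℝ) : Measure ℝ := (expMeasure 1).map (fun t => t ^ (-1 / α))

lemma expMeasure_Iic {s : ℝ} (hs : 0 ≤ s) :
    expMeasure 1 (Set.Iic s) = ENNReal.ofReal (1 - Real.exp (-s)) := by
  have := isProbabilityMeasure_expMeasure one_pos
  rw [← ofReal_cdf, cdf_expMeasure_eq one_pos]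
  simp [hs]

instance nullSingletonClass_expMeasure : NullSingletonClass (expMeasure 1) := by
  unfold expMeasure gammaMeasure
  infer_instance

lemma ae_expMeasure_pos : ∀ᵐ t ∂(expMeasure 1), 0 < t := by
  have h := expMeasure_Iic (le_refl (0 : ℝ))
  rw [ae_iff]
  simpa [Set.Iic] using h

lemma expMeasure_Ici {s : ℝ} (hs : 0 ≤ s) :
    expMeasure 1 (Set.Ici s) = ENNReal.ofReal (Real.exp (-s)) := by
  have := isProbabilityMeasure_expMeasure one_pos
  have h : expMeasure 1 (Set.Iio s) = ENNReal.ofReal (1 - Real.exp (-s)) := by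
    rw [← expMeasure_Iic hs]
    exact measure_congr Iio_ae_eq_Iic
  rw [← Set.compl_Iio, prob_compl_eq_one_sub measurableSet_Iio, h, ← ENNReal.ofReal_one,
    ← ENNReal.ofReal_sub _ (by simp [hs])]
  simp

/-- Tilting the exponential density by `exp (-(c * t))` gives `1 / (1 + c)` times the exponential
density of rate `1 + c`. -/
lemma lintegral_exp_expMeasure {c : ℝ} (hc : 0 ≤ c) :
    ∫⁻ t, ENNReal.ofReal (Real.exp (-(c * t))) ∂(expMeasure 1) = ENNReal.ofReal (1 / (1 + c)) := by
  have h1 : (0 : ℝ) < 1 + c := by positivity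
  have : expMeasure 1 = (volume : Measure ℝ).withDensity (exponentialPDF 1) := rfl
  have hm : Measurable (exponentialPDF 1) := (measurable_exponentialPDFReal 1).ennreal_ofReal
  rw [this, lintegral_withDensity_eq_lintegral_mul _ hm (by fun_prop)]
  have h2 : ∀ t, (exponentialPDF 1 * fun t => ENNReal.ofReal (Real.exp (-(c * t)))) t
      = ENNReal.ofReal (1 / (1 + c)) * exponentialPDF (1 + c) t := by
    intro t
    simp only [Pi.mul_apply, exponentialPDF_eq]
    split_ifs
    · rw [← ENNReal.ofReal_mul (by positivity), ← ENNReal.ofReal_mul (by positivity)]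
      congr 1
      rw [one_mul, ← Real.exp_add]
      field_simp
      congr 1
      ring
    · simp
  simp_rw [h2]
  have hm' : Measurable (exponentialPDF (1 + c)) :=
    (measurable_exponentialPDFReal _).ennreal_ofReal
  rw [lintegral_const_mul _ hm', lintegral_exponentialPDF_eq_one h1, mul_one]

section frechet

variable {α : ℝ}

lemma measurable_rpow_neg (a : ℝ) : Measurable (fun t : ℝ => t ^ a) := by fun_prop

instance isProbabilityMeasure_frechet : IsProbabilityMeasure (frechet α) := by
  have := isProbabilityMeasure_expMeasure one_pos
  exact Measure.isProbabilityMeasure_map (measurable_rpow_neg _).aemeasurable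

lemma ae_frechet_pos : ∀ᵐ z ∂(frechet α), 0 < z := by
  rw [frechet, ae_map_iff (measurable_rpow_neg _).aemeasurable measurableSet_Ioi]
  filter_upwards [ae_expMeasure_pos] with t ht using Real.rpow_pos_of_pos ht _

lemma rpow_neg_inv_le_iff (hα : 0 < α) {t x : ℝ} (ht : 0 < t) (hx : 0 < x) :
    t ^ (-1 / α) ≤ x ↔ x ^ (-α) ≤ t := by
  have h : t = (t ^ (-1 / α)) ^ (-α) := by
    rw [← Real.rpow_mul ht.le]
    field_simp
    simp
  conv_rhs => rw [h]
  rw [Real.rpow_le_rpow_iff_of_neg hx (Real.rpow_pos_of_pos ht _) (by linarith)]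

lemma frechet_Iic (hα : 0 < α) {x : ℝ} (hx : 0 < x) :
    frechet α (Set.Iic x) = ENNReal.ofReal (Real.exp (-(x ^ (-α)))) := by
  rw [frechet, Measure.map_apply (measurable_rpow_neg _) measurableSet_Iic,
    ← expMeasure_Ici (Real.rpow_nonneg hx.le _)]
  apply measure_congr
  filter_upwards [ae_expMeasure_pos] with t ht
  exact propext (rpow_neg_inv_le_iff hα ht hx)

lemma frechet_Iic_of_nonpos {x : ℝ} (hx : x ≤ 0) : frechet α (Set.Iic x) = 0 := by
  have h : ∀ᵐ z ∂(frechet α), ¬ z ≤ x := by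
    filter_upwards [ae_frechet_pos] with z hz using by linarith
  simpa [ae_iff, Set.Iic] using h

/-- A law on `ℝ` is determined by its distribution function, so the existential in
`HasImplicitFrechetLaw` can be replaced by the concrete measure `frechet α`. -/
lemma isStandardFrechet_iff (hα : 0 < α) {ν : Measure ℝ} :
    IsStandardFrechet α ν ↔ ν = frechet α := by
  constructor
  · rintro ⟨h1, h2, h3⟩
    refine Measure.ext_of_Iic _ _ fun x => ?_
    rcases lt_or_ge 0 x with hx | hx
    · rw [h2 x hx, frechet_Iic hα hx]
    · rw [h3 x hx, frechet_Iic_of_nonpos hx]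
  · rintro rfl
    exact ⟨inferInstance, fun x hx => frechet_Iic hα hx, fun x hx => frechet_Iic_of_nonpos hx⟩

lemma frechet_Iio (hα : 0 < α) {x : ℝ} (hx : 0 < x) :
    frechet α (Set.Iio x) = ENNReal.ofReal (Real.exp (-(x ^ (-α)))) := by
  rw [frechet, Measure.map_apply (measurable_rpow_neg _) measurableSet_Iio,
    ← expMeasure_Ici (Real.rpow_nonneg hx.le _), ← measure_congr (Ioi_ae_eq_Ici (a := x ^ (-α)))]
  apply measure_congr
  filter_upwards [ae_expMeasure_pos] with t ht
  have h : t = (t ^ (-1 / α)) ^ (-α) := by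
    rw [← Real.rpow_mul ht.le]
    field_simp
    simp
  apply propext
  change t ^ (-1 / α) < x ↔ x ^ (-α) < t
  conv_rhs => rw [h]
  rw [Real.rpow_lt_rpow_iff_of_neg hx (Real.rpow_pos_of_pos ht _) (by linarith)]

/-- `Z ^ (-α)` is standard exponential, so this is a Laplace transform. It averages the conditional
winning probability in `le_measure_wins`. -/
lemma lintegral_exp_frechet (hα : 0 < α) {c : ℝ} (hc : 0 ≤ c) :
    ∫⁻ z, ENNReal.ofReal (Real.exp (-(c * z ^ (-α)))) ∂(frechet α)
      = ENNReal.ofReal (1 / (1 + c)) := by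
  rw [frechet, lintegral_map (by fun_prop) (measurable_rpow_neg _), ← lintegral_exp_expMeasure hc]
  apply lintegral_congr_ae
  filter_upwards [ae_expMeasure_pos] with t ht
  rw [← Real.rpow_mul ht.le]
  have : -1 / α * -α = 1 := by field_simp
  simp [this]

lemma div_rpow_eq {s x : ℝ} (hs : 0 ≤ s) (hx : 0 < x) : (s / x) ^ α = s ^ α * x ^ (-α) := by
  rw [Real.div_rpow hs hx.le, Real.rpow_neg hx.le]
  rfl

lemma frechet_mul_le (hα : 0 < α) {s x : ℝ} (hs : 0 ≤ s) (hx : 0 < x) :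
    frechet α {z | s * z ≤ x} = ENNReal.ofReal (Real.exp (-(s ^ α * x ^ (-α)))) := by
  rcases hs.eq_or_lt with rfl | hs
  · simp [hx.le, hα.ne']
  · have : {z | s * z ≤ x} = Set.Iic (x / s) := by
      ext z
      simp [le_div_iff₀' hs]
    rw [this, frechet_Iic hα (by positivity), div_rpow_eq hx.le hs, neg_neg, mul_comm]

lemma frechet_mul_lt (hα : 0 < α) {s x : ℝ} (hs : 0 ≤ s) (hx : 0 < x) :
    frechet α {z | s * z < x} = ENNReal.ofReal (Real.exp (-(s ^ α * x ^ (-α)))) := by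
  rcases hs.eq_or_lt with rfl | hs
  · simp [hx, hα.ne']
  · have : {z | s * z < x} = Set.Iio (x / s) := by
      ext z
      simp [lt_div_iff₀' hs]
    rw [this, frechet_Iio hα (by positivity), div_rpow_eq hx.le hs, neg_neg, mul_comm]

lemma frechet_mul_le_zero {s : ℝ} (hs : 0 ≤ s) :
    frechet α {z | s * z ≤ 0} = if s = 0 then 1 else 0 := by
  split_ifs with h
  · simp [h]
  · have hs : 0 < s := lt_of_le_of_ne hs (Ne.symm h)
    have : ∀ᵐ z ∂(frechet α), ¬ s * z ≤ 0 := by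
      filter_upwards [ae_frechet_pos] with z hz
      simpa using mul_pos hs hz
    simpa [ae_iff] using this

lemma frechet_mul_le_neg {s x : ℝ} (hs : 0 ≤ s) (hx : x < 0) :
    frechet α {z | s * z ≤ x} = 0 := by
  have : ∀ᵐ z ∂(frechet α), ¬ s * z ≤ x := by
    filter_upwards [ae_frechet_pos] with z hz
    have := mul_nonneg hs hz.le
    linarith
  simpa [ae_iff] using this

/-- The maximum of two independent `α`-Fréchet variables is `α`-Fréchet. -/
lemma map_max_frechet (hα : 0 < α) {s t : ℝ} (hs : 0 ≤ s) (ht : 0 ≤ t) :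
    ((frechet α).prod (frechet α)).map (fun p => max (s * p.1) (t * p.2))
      = (frechet α).map (fun z => (s ^ α + t ^ α) ^ (1 / α) * z) := by
  have : IsProbabilityMeasure
      (((frechet α).prod (frechet α)).map (fun p => max (s * p.1) (t * p.2))) :=
    Measure.isProbabilityMeasure_map (by fun_prop)
  have hs' := Real.rpow_nonneg hs α
  have ht' := Real.rpow_nonneg ht α
  have hc : 0 ≤ (s ^ α + t ^ α) ^ (1 / α) := by positivity
  refine Measure.ext_of_Iic _ _ fun x => ?_
  rw [Measure.map_apply (by fun_prop) measurableSet_Iic,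
    Measure.map_apply (by fun_prop) measurableSet_Iic]
  have e1 : (fun p : ℝ × ℝ => max (s * p.1) (t * p.2)) ⁻¹' Set.Iic x
      = {z | s * z ≤ x} ×ˢ {z | t * z ≤ x} := by
    ext p
    simp
  have e2 : (fun z => (s ^ α + t ^ α) ^ (1 / α) * z) ⁻¹' Set.Iic x
      = {z | (s ^ α + t ^ α) ^ (1 / α) * z ≤ x} := rfl
  rw [e1, e2, Measure.prod_prod]
  rcases lt_trichotomy x 0 with hx | rfl | hx
  · rw [frechet_mul_le_neg hs hx, frechet_mul_le_neg hc hx, zero_mul]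
  -- At `x = 0` only a zero scale contributes, through its atom at the origin.
  · rw [frechet_mul_le_zero hs, frechet_mul_le_zero ht, frechet_mul_le_zero hc]
    have : (s ^ α + t ^ α) ^ (1 / α) = 0 ↔ s = 0 ∧ t = 0 := by
      rw [Real.rpow_eq_zero (by positivity) (by positivity), add_eq_zero_iff_of_nonneg hs' ht',
        Real.rpow_eq_zero hs hα.ne', Real.rpow_eq_zero ht hα.ne']
    simp only [this]
    split_ifs <;> simp_all
  · rw [frechet_mul_le hα hs hx, frechet_mul_le hα ht hx, frechet_mul_le hα hc hx,
      ← ENNReal.ofReal_mul (by positivity), ← Real.exp_add, ← Real.rpow_mul (by positivity)]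
    congr 2
    rw [one_div_mul_cancel hα.ne', Real.rpow_one]
    ring

end frechet

/-! ### Algebra and measurability of `∨_f` -/

section fMax

variable {d : ℕ} {f : Vec d → ℝ}

lemma IsLossFunction.map_zero (hf : IsLossFunction f) : f 0 = 0 := (hf.eq_zero_iff 0).2 rfl

lemma apply_fJoin (f : Vec d → ℝ) (x y : Vec d) : f (fJoin f x y) = max (f x) (f y) := by
  unfold fJoin
  split_ifs with h
  · rw [max_eq_left h]
  · rw [max_eq_right (le_of_not_ge h)]

lemma fJoin_eq_or (f : Vec d → ℝ) (x y : Vec d) : fJoin f x y = x ∨ fJoin f x y = y := by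
  unfold fJoin
  split_ifs <;> simp

lemma exists_fMax_eq (f : Vec d → ℝ) (k : ℕ) (x : Fin (k + 1) → Vec d) :
    ∃ j, fMax f k x = x j := by
  induction k with
  | zero => exact ⟨0, rfl⟩
  | succ k ih =>
    rcases fJoin_eq_or f (fMax f k (fun j => x j.castSucc)) (x (Fin.last (k + 1))) with h | h
    · obtain ⟨j, hj⟩ := ih (fun j => x j.castSucc)
      exact ⟨j.castSucc, h.trans hj⟩
    · exact ⟨_, h⟩

lemma le_apply_fMax (f : Vec d → ℝ) (k : ℕ) (x : Fin (k + 1) → Vec d) (j : Fin (k + 1)) :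
    f (x j) ≤ f (fMax f k x) := by
  induction k with
  | zero => rw [Fin.fin_one_eq_zero j]; rfl
  | succ k ih =>
    rw [fMax, apply_fJoin f]
    induction j using Fin.lastCases with
    | last => exact le_max_right _ _
    | cast j => exact (ih (fun j => x j.castSucc) j).trans (le_max_left _ _)

lemma fJoin_smul (hf : IsLossFunction f) {c : ℝ} (hc : 0 ≤ c) (x y : Vec d) :
    fJoin f (c • x) (c • y) = c • fJoin f x y := by
  unfold fJoin
  rw [hf.homogeneous c x hc, hf.homogeneous c y hc]
  rcases hc.eq_or_lt with rfl | hc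
  · simp
  · simp only [mul_le_mul_iff_right₀ hc]
    split_ifs <;> rfl

lemma fMax_smul (hf : IsLossFunction f) {c : ℝ} (hc : 0 ≤ c) (k : ℕ) (x : Fin (k + 1) → Vec d) :
    fMax f k (fun j => c • x j) = c • fMax f k x := by
  induction k with
  | zero => rfl
  | succ k ih => rw [fMax, ih, fJoin_smul hf hc, fMax]

lemma measurable_fJoin (hf : IsLossFunction f) :
    Measurable (fun p : Vec d × Vec d => fJoin f p.1 p.2) := by
  have := hf.continuous.measurable
  exact Measurable.ite (measurableSet_le (by fun_prop) (by fun_prop)) measurable_fst measurable_snd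

lemma measurable_fMax (hf : IsLossFunction f) (k : ℕ) :
    Measurable (fun x : Fin (k + 1) → Vec d => fMax f k x) := by
  induction k with
  | zero => exact measurable_pi_apply 0
  | succ k ih =>
    exact (measurable_fJoin hf).comp
      ((ih.comp (measurable_pi_lambda _ fun j => measurable_pi_apply j.castSucc)).prodMk
        (measurable_pi_apply (Fin.last (k + 1))))

end fMax

/-! ### The laws `Φ^f_{α,κ}(σ)` and their max-stability -/

section implFrechet

variable {d : ℕ} {f : Vec d → ℝ} {α : ℝ} {κ : Measure {x : Vec d // f x = 1}}

/-- The law `Φ^f_{α,κ}(σ)` of `σ Z Θ`. -/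
noncomputable def implFrechet (α : ℝ) (κ : Measure {x : Vec d // f x = 1}) (σ : ℝ) :
    Measure (Vec d) :=
  ((frechet α).prod κ).map (fun p => (σ * p.1) • (p.2 : Vec d))

lemma hasImplicitFrechetLaw_iff (hα : 0 < α) {σ : ℝ} {Ω : Type*} [MeasurableSpace Ω]
    {P : Measure Ω} {Y : Ω → Vec d} :
    HasImplicitFrechetLaw f α κ σ P Y ↔ P.map Y = implFrechet α κ σ := by
  constructor
  · rintro ⟨ν, hν, h⟩
    rw [isStandardFrechet_iff hα] at hν
    rw [h, hν, implFrechet]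
  · exact fun h => ⟨_, (isStandardFrechet_iff hα).2 rfl, h⟩

lemma measurable_polar (σ : ℝ) :
    Measurable (fun p : ℝ × {x : Vec d // f x = 1} => (σ * p.1) • (p.2 : Vec d)) := by
  fun_prop

instance isProbabilityMeasure_implFrechet [IsProbabilityMeasure κ] {σ : ℝ} :
    IsProbabilityMeasure (implFrechet α κ σ) :=
  Measure.isProbabilityMeasure_map (measurable_polar σ).aemeasurable

lemma lintegral_implFrechet [IsProbabilityMeasure κ] {σ : ℝ} {g : Vec d → ℝ≥0∞}
    (hg : Measurable g) :
    ∫⁻ x, g x ∂(implFrechet α κ σ)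
      = ∫⁻ z, ∫⁻ θ, g ((σ * z) • (θ : Vec d)) ∂κ ∂(frechet α) := by
  rw [implFrechet, lintegral_map hg (measurable_polar σ), lintegral_prod]
  exact (hg.comp (measurable_polar σ)).aemeasurable

lemma map_smul_implFrechet (c σ : ℝ) :
    (implFrechet α κ σ).map (fun x => c • x) = implFrechet α κ (c * σ) := by
  rw [implFrechet, Measure.map_map (by fun_prop) (measurable_polar σ), implFrechet]
  congr 1
  ext p : 1
  simp [mul_smul]

lemma implFrechet_zero [IsProbabilityMeasure κ] :
    implFrechet α κ 0 = Measure.dirac (0 : Vec d) := by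
  have : (fun p : ℝ × {x : Vec d // f x = 1} => ((0 : ℝ) * p.1) • (p.2 : Vec d))
      = fun _ => 0 := by
    ext p : 1
    simp
  rw [implFrechet, this, Measure.map_const]
  simp

lemma apply_polar (hf : IsLossFunction f) {c : ℝ} (hc : 0 ≤ c) (θ : {x : Vec d // f x = 1}) :
    f (c • (θ : Vec d)) = c := by
  rw [hf.homogeneous c _ hc, θ.2, mul_one]

/-- The loss of a `Φ^f_{α,κ}(σ)`-distributed vector is `σ`-Fréchet. -/
lemma map_loss_implFrechet [IsProbabilityMeasure κ] (hf : IsLossFunction f) {σ : ℝ}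
    (hσ : 0 ≤ σ) : (implFrechet α κ σ).map f = (frechet α).map (fun z => σ * z) := by
  rw [implFrechet, Measure.map_map hf.continuous.measurable (measurable_polar σ)]
  have h1 : (frechet α).map (fun z => σ * z)
      = (((frechet α).prod κ).map Prod.fst).map (fun z => σ * z) := by
    simp
  rw [h1, Measure.map_map (by fun_prop) measurable_fst]
  apply Measure.map_congr
  have : ∀ᵐ p ∂((frechet α).prod κ), 0 < p.1 :=
    Measure.quasiMeasurePreserving_fst.ae ae_frechet_pos
  filter_upwards [this] with p hp
  exact apply_polar hf (mul_nonneg hσ hp.le) p.2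

/-- For fixed radii the comparison ignores the angles. Whichever angle survives is `κ`-distributed,
and the other integrates out. -/
lemma lintegral_fJoin_polar [IsProbabilityMeasure κ] (hf : IsLossFunction f)
    {g : Vec d → ℝ≥0∞} {r s : ℝ} (hr : 0 ≤ r) (hs : 0 ≤ s) :
    ∫⁻ θ, ∫⁻ θ', g (fJoin f (r • (θ : Vec d)) (s • (θ' : Vec d))) ∂κ ∂κ
      = ∫⁻ θ, g (max r s • (θ : Vec d)) ∂κ := by
  unfold fJoin
  simp only [apply_polar hf hr, apply_polar hf hs]
  split_ifs with h
  · simp [max_eq_left h]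
  · simp [max_eq_right (le_of_not_ge h)]

lemma map_fJoin_implFrechet [IsProbabilityMeasure κ] (hf : IsLossFunction f) (hα : 0 < α)
    {σ τ : ℝ} (hσ : 0 ≤ σ) (hτ : 0 ≤ τ) :
    ((implFrechet α κ σ).prod (implFrechet α κ τ)).map (fun p => fJoin f p.1 p.2)
      = implFrechet α κ ((σ ^ α + τ ^ α) ^ (1 / α)) := by
  refine Measure.ext_of_lintegral _ fun g hg => ?_
  have hJ := measurable_fJoin hf
  have hgJ : Measurable (fun p : Vec d × Vec d => g (fJoin f p.1 p.2)) := hg.comp hJ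
  have hpol := measurable_polar (f := f)
  have m4 : Measurable (fun q : (ℝ × {x : Vec d // f x = 1}) × (ℝ × {x : Vec d // f x = 1}) =>
      g (fJoin f ((σ * q.1.1) • (q.1.2 : Vec d)) ((τ * q.2.1) • (q.2.2 : Vec d)))) :=
    hgJ.comp (((hpol σ).comp measurable_fst).prodMk ((hpol τ).comp measurable_snd))
  rw [lintegral_map hg hJ, lintegral_prod _ hgJ.aemeasurable,
    lintegral_implFrechet hgJ.lintegral_prod_right', lintegral_implFrechet hg]
  have e1 : ∀ x : Vec d, ∫⁻ y, g (fJoin f x y) ∂(implFrechet α κ τ)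
      = ∫⁻ z', ∫⁻ θ', g (fJoin f x ((τ * z') • (θ' : Vec d))) ∂κ ∂(frechet α) :=
    fun x => lintegral_implFrechet (hgJ.comp measurable_prodMk_left)
  simp_rw [e1]
  -- Tonelli moves both angular integrals inside, so that `lintegral_fJoin_polar` applies at fixed
  -- radii.
  have e2 : ∀ z : ℝ, ∫⁻ θ, ∫⁻ z', ∫⁻ θ', g (fJoin f ((σ * z) • (θ : Vec d))
        ((τ * z') • (θ' : Vec d))) ∂κ ∂(frechet α) ∂κ
      = ∫⁻ z', ∫⁻ θ, ∫⁻ θ', g (fJoin f ((σ * z) • (θ : Vec d))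
        ((τ * z') • (θ' : Vec d))) ∂κ ∂κ ∂(frechet α) := by
    intro z
    refine lintegral_lintegral_swap ?_
    refine (Measurable.lintegral_prod_right'
      (f := fun q : ({x : Vec d // f x = 1} × ℝ) × {x : Vec d // f x = 1} =>
        g (fJoin f ((σ * z) • (q.1.1 : Vec d)) ((τ * q.1.2) • (q.2 : Vec d)))) ?_).aemeasurable
    exact m4.comp (f := fun q : ({x : Vec d // f x = 1} × ℝ) × {x : Vec d // f x = 1} =>
      ((z, q.1.1), (q.1.2, q.2))) (by fun_prop)
  simp_rw [e2]
  have mG : Measurable (fun r : ℝ => ∫⁻ θ : {x : Vec d // f x = 1}, g (r • (θ : Vec d)) ∂κ) := by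
    refine Measurable.lintegral_prod_right'
      (f := fun q : ℝ × {x : Vec d // f x = 1} => g (q.1 • (q.2 : Vec d))) ?_
    exact hg.comp (by fun_prop)
  have e3 : ∫⁻ z, ∫⁻ z', ∫⁻ θ, ∫⁻ θ', g (fJoin f ((σ * z) • (θ : Vec d))
        ((τ * z') • (θ' : Vec d))) ∂κ ∂κ ∂(frechet α) ∂(frechet α)
      = ∫⁻ z, ∫⁻ z', ∫⁻ θ, g (max (σ * z) (τ * z') • (θ : Vec d)) ∂κ
        ∂(frechet α) ∂(frechet α) := by
    refine lintegral_congr_ae ?_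
    filter_upwards [ae_frechet_pos] with z hz
    refine lintegral_congr_ae ?_
    filter_upwards [ae_frechet_pos] with z' hz'
    exact lintegral_fJoin_polar hf (mul_nonneg hσ hz.le) (mul_nonneg hτ hz'.le)
  have mmax : Measurable (fun p : ℝ × ℝ => max (σ * p.1) (τ * p.2)) := by fun_prop
  rw [e3, ← lintegral_map (f := fun r : ℝ => ∫⁻ θ, g (r • (θ : Vec d)) ∂κ) mG (by fun_prop),
    ← map_max_frechet hα hσ hτ, lintegral_map mG mmax, lintegral_prod]
  exact (mG.comp mmax).aemeasurable

lemma map_fJoin_of_indepFun [IsProbabilityMeasure κ] (hf : IsLossFunction f) (hα : 0 < α)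
    {Ω : Type*} [MeasurableSpace Ω] {P : Measure Ω} [IsProbabilityMeasure P] {X Y : Ω → Vec d}
    (hX : Measurable X) (hY : Measurable Y) (hXY : IndepFun X Y P) {σ τ : ℝ} (hσ : 0 ≤ σ)
    (hτ : 0 ≤ τ) (lX : P.map X = implFrechet α κ σ) (lY : P.map Y = implFrechet α κ τ) :
    P.map (fun ω => fJoin f (X ω) (Y ω)) = implFrechet α κ ((σ ^ α + τ ^ α) ^ (1 / α)) := by
  rw [indepFun_iff_map_prod_eq_prod_map_map hX.aemeasurable hY.aemeasurable, lX, lY] at hXY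
  rw [← map_fJoin_implFrechet hf hα hσ hτ, ← hXY,
    Measure.map_map (measurable_fJoin hf) (hX.prodMk hY)]
  rfl

lemma map_fMax_of_iIndepFun [IsProbabilityMeasure κ] (hf : IsLossFunction f) (hα : 0 < α)
    {Ω : Type*} [MeasurableSpace Ω] {P : Measure Ω} [IsProbabilityMeasure P] (k : ℕ)
    {X : Fin (k + 1) → Ω → Vec d} (hX : ∀ j, Measurable (X j)) (hind : iIndepFun X P)
    {σ : Fin (k + 1) → ℝ} (hσ : ∀ j, 0 ≤ σ j) (lX : ∀ j, P.map (X j) = implFrechet α κ (σ j)) :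
    P.map (fun ω => fMax f k (fun j => X j ω))
      = implFrechet α κ ((∑ j, σ j ^ α) ^ (1 / α)) := by
  induction k with
  | zero =>
    simp only [fMax, Fin.sum_univ_succ, Finset.univ_eq_empty, Finset.sum_empty, add_zero]
    rw [← Real.rpow_mul (hσ 0), mul_one_div_cancel hα.ne', Real.rpow_one]
    exact lX 0
  | succ k ih =>
    have h1 := ih (fun j => hX j.castSucc) (hind.precomp (Fin.castSucc_injective _))
      (fun j => hσ j.castSucc) (fun j => lX j.castSucc)
    have hmeas : Measurable (fun ω => fMax f k (fun j => X j.castSucc ω)) :=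
      (measurable_fMax hf k).comp (measurable_pi_lambda _ fun j => hX j.castSucc)
    have h2 : IndepFun (fun ω => fMax f k (fun j => X j.castSucc ω)) (X (Fin.last (k + 1))) P := by
      have h := hind.indepFun_finset (Finset.univ.erase (Fin.last (k + 1))) {Fin.last (k + 1)}
        (by simp) hX
      have hψ : Measurable fun y : ({Fin.last (k + 1)} : Finset (Fin (k + 1 + 1))) → Vec d =>
          y ⟨Fin.last (k + 1), by simp⟩ := measurable_pi_apply _
      exact h.comp
        (φ := fun y => fMax f k fun j => y ⟨j.castSucc, by simp [Fin.castSucc_ne_last]⟩)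
        ((measurable_fMax hf k).comp (measurable_pi_lambda _ fun j => measurable_pi_apply _)) hψ
    have hS : 0 ≤ ∑ j : Fin (k + 1), σ j.castSucc ^ α :=
      Finset.sum_nonneg fun j _ => Real.rpow_nonneg (hσ _) _
    have h3 := map_fJoin_of_indepFun hf hα hmeas (hX _) h2 (by positivity) (hσ _) h1 (lX _)
    rw [← Real.rpow_mul hS, one_div_mul_cancel hα.ne', Real.rpow_one] at h3
    rw [Fin.sum_univ_castSucc]
    exact h3

/-- A `Φ^f_{α,κ}(σ)`-distributed vector is `f`-implicit max-stable. -/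
lemma isImplicitMaxStable_of_map_eq [IsProbabilityMeasure κ] (hf : IsLossFunction f) (hα : 0 < α)
    {Ω : Type*} [MeasurableSpace Ω] {P : Measure Ω} [IsProbabilityMeasure P] {Y : Ω → Vec d}
    (hY : Measurable Y) {σ : ℝ} (hσ : 0 ≤ σ) (lY : P.map Y = implFrechet α κ σ) :
    IsImplicitMaxStable f P Y := by
  -- The maximum of `k + 1` copies has scale `((k + 1) * σ ^ α) ^ (1 / α)`, which dictates the
  -- norming constant.
  refine ⟨hY, fun k => ⟨((k : ℝ) + 1) ^ (1 / α), by positivity, ?_⟩⟩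
  rw [lY]
  have h := map_fMax_of_iIndepFun (κ := κ) hf hα
    (P := Measure.pi (fun _ : Fin (k + 1) => implFrechet α κ σ)) k
    (X := fun j y => y j) (fun j => measurable_pi_apply j)
    (iIndepFun_pi (X := fun _ => id) fun _ => aemeasurable_id) (σ := fun _ => σ) (fun _ => hσ)
    (fun j => by
      have := (measurePreserving_eval (fun _ : Fin (k + 1) => implFrechet α κ σ) j).map_eq
      exact this)
  have e : (fun y : Fin (k + 1) → Vec d => (((k : ℝ) + 1) ^ (1 / α))⁻¹ • fMax f k y)
      = (fun x => (((k : ℝ) + 1) ^ (1 / α))⁻¹ • x) ∘ fun y => fMax f k y := rfl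
  rw [e, ← Measure.map_map (by fun_prop) (measurable_fMax hf k)]
  erw [h]
  rw [map_smul_implFrechet]
  congr 1
  rw [Finset.sum_const, Finset.card_univ, Fintype.card_fin, nsmul_eq_mul,
    Real.mul_rpow (by positivity) (by positivity), ← Real.rpow_mul hσ,
    mul_one_div_cancel hα.ne', Real.rpow_one]
  push_cast
  field_simp

end implFrechet

/-! ### Competition of independent Fréchet variables -/

section competition

variable {β : Type*} [Fintype β]

/-- Either all `w b * x b` vanish, or some `u b * x b` is positive and exceeds all other
`w c * x c`. -/
def ClearWinner (u w x : β → ℝ) : Prop :=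
  (∀ b, w b * x b = 0) ∨ ∃ b, 0 < u b * x b ∧ ∀ c, c ≠ b → w c * x c < u b * x b

variable {Ω : Type*} [MeasurableSpace Ω] {P : Measure Ω} [IsProbabilityMeasure P]
  {α : ℝ} {X : β → Ω → ℝ} {σ : β → ℝ} {u w : β → ℝ}

lemma measurableSet_wins (hX : ∀ b, Measurable (X b)) (b : β) :
    MeasurableSet {ω | 0 < u b * X b ω ∧ ∀ c, c ≠ b → w c * X c ω < u b * X b ω} := by
  have h0 : MeasurableSet {ω | 0 < u b * X b ω} :=
    measurableSet_lt measurable_const (by fun_prop)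
  refine h0.inter ?_
  have : {ω | ∀ c, c ≠ b → w c * X c ω < u b * X b ω}
      = ⋂ c, ⋂ (_ : c ≠ b), {ω | w c * X c ω < u b * X b ω} := by
    ext ω
    simp
  change MeasurableSet {ω | ∀ c, c ≠ b → w c * X c ω < u b * X b ω}
  rw [this]
  exact MeasurableSet.iInter fun c => MeasurableSet.iInter fun _ =>
    measurableSet_lt (by fun_prop) (by fun_prop)

omit [Fintype β] [IsProbabilityMeasure P] in
lemma measure_forall_mul_lt (hα : 0 < α) (hX : ∀ b, Measurable (X b)) (hind : iIndepFun X P)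
    (hσ : ∀ b, 0 ≤ σ b) (lX : ∀ b, P.map (X b) = (frechet α).map (fun z => σ b * z))
    (hw : ∀ b, 0 ≤ w b) (T : Finset β) {y : ℝ} (hy : 0 < y) :
    P {ω | ∀ c ∈ T, w c * X c ω < y}
      = ENNReal.ofReal (Real.exp (-((∑ c ∈ T, (w c * σ c) ^ α) * y ^ (-α)))) := by
  have e : {ω | ∀ c ∈ T, w c * X c ω < y} = ⋂ c ∈ T, X c ⁻¹' {x | w c * x < y} := by
    ext ω
    simp
  have hm : ∀ c, MeasurableSet {x : ℝ | w c * x < y} := fun c =>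
    measurableSet_lt (by fun_prop) measurable_const
  rw [e, hind.measure_inter_preimage_eq_mul T (fun c _ => hm c)]
  have h : ∀ c ∈ T, P (X c ⁻¹' {x | w c * x < y})
      = ENNReal.ofReal (Real.exp (-((w c * σ c) ^ α * y ^ (-α)))) := by
    intro c _
    rw [← Measure.map_apply (hX c) (hm c), lX c, Measure.map_apply (by fun_prop) (hm c),
      ← frechet_mul_lt hα (mul_nonneg (hw c) (hσ c)) hy]
    simp [mul_assoc]
  rw [Finset.prod_congr rfl h, ← ENNReal.ofReal_prod_of_nonneg (fun c _ => (Real.exp_pos _).le),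
    ← Real.exp_sum, Finset.sum_mul, Finset.sum_neg_distrib]

-- Put `s = u b * σ b` and let `B` be the sum over the rivals. Given `X b = σ b * z`, all rivals
-- stay below `s * z` with probability `exp (-(B / s ^ α * z ^ (-α)))`. Averaging over `z` gives `s
-- ^ α / (s ^ α + B)`, and enlarging `s ^ α` to `(w b * σ b) ^ α` in the denominator only lowers it.
open Classical in
lemma le_measure_wins (hα : 0 < α) (hX : ∀ b, Measurable (X b)) (hind : iIndepFun X P)
    (hσ : ∀ b, 0 ≤ σ b) (lX : ∀ b, P.map (X b) = (frechet α).map (fun z => σ b * z))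
    (hu : ∀ b, 0 ≤ u b) (huw : ∀ b, u b ≤ w b) (b : β) :
    ENNReal.ofReal ((u b * σ b) ^ α / ∑ c, (w c * σ c) ^ α)
      ≤ P {ω | 0 < u b * X b ω ∧ ∀ c, c ≠ b → w c * X c ω < u b * X b ω} := by
  have hw : ∀ b, 0 ≤ w b := fun b => (hu b).trans (huw b)
  rcases (mul_nonneg (hu b) (hσ b)).eq_or_lt with h0 | hs
  · rw [← h0, Real.zero_rpow hα.ne', zero_div, ENNReal.ofReal_zero]
    exact zero_le
  set s := u b * σ b with hsdef
  have hpos : ∀ᵐ ω ∂P, 0 < u b * X b ω := by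
    have h : ∀ᵐ x ∂(P.map (X b)), 0 < u b * x := by
      rw [lX b, ae_map_iff (by fun_prop) (measurableSet_lt (by fun_prop) (by fun_prop))]
      filter_upwards [ae_frechet_pos] with z hz
      have := mul_pos hs hz
      rwa [mul_assoc] at this
    exact ae_of_ae_map (hX b).aemeasurable h
  refine le_trans ?_ (measure_mono_ae (s := {ω | ∀ c, c ≠ b → w c * X c ω < u b * X b ω})
    (hpos.mono fun ω h1 h2 => ⟨h1, h2⟩))
  obtain ⟨T, hT⟩ : ∃ T : Finset β, T = Finset.univ.erase b := ⟨_, rfl⟩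
  have hTmem : ∀ c, c ∈ T ↔ c ≠ b := by simp [hT]
  set B := ∑ c ∈ T, (w c * σ c) ^ α with hB
  have hB0 : 0 ≤ B := Finset.sum_nonneg fun c _ => Real.rpow_nonneg (mul_nonneg (hw c) (hσ c)) _
  have hW : ∑ c, (w c * σ c) ^ α = (w b * σ b) ^ α + B := by
    rw [hB, hT]
    exact (Finset.add_sum_erase _ _ (Finset.mem_univ b)).symm
  have hsα : 0 < s ^ α := Real.rpow_pos_of_pos hs _
  have hsw : s ^ α ≤ (w b * σ b) ^ α :=
    Real.rpow_le_rpow hs.le (mul_le_mul_of_nonneg_right (huw b) (hσ b)) hα.le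
  have hind2 := hind.indepFun_finset {b} T (by simp [hTmem]) hX
  have hind3 : IndepFun (X b)
      (fun ω (c : T) => X c ω) P :=
    hind2.comp (φ := fun y : ({b} : Finset β) → ℝ => y ⟨b, by simp⟩) (ψ := id)
      (by fun_prop) measurable_id
  have hR : Measurable (fun ω (c : T) => X c ω) :=
    measurable_pi_lambda _ fun c => hX c
  rw [indepFun_iff_map_prod_eq_prod_map_map (hX b).aemeasurable hR.aemeasurable] at hind3
  have : IsProbabilityMeasure (P.map (fun ω (c : T) => X c ω)) :=
    Measure.isProbabilityMeasure_map hR.aemeasurable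
  let S : Set (ℝ × (T → ℝ)) :=
    ⋂ c : T, {p | w c * p.2 c < u b * p.1}
  have hS : MeasurableSet S := MeasurableSet.iInter fun c =>
    measurableSet_lt (by fun_prop) (by fun_prop)
  have e1 : {ω | ∀ c, c ≠ b → w c * X c ω < u b * X b ω}
      = (fun ω => (X b ω, fun c : T => X c ω)) ⁻¹' S := by
    ext ω
    simp [S, hTmem]
  have e2 : ∀ x : ℝ, P.map (fun ω (c : T) => X c ω)
      (Prod.mk x ⁻¹' S) = P {ω | ∀ c ∈ T, w c * X c ω < u b * x} := by
    intro x
    rw [Measure.map_apply hR (measurable_prodMk_left hS)]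
    congr 1
    ext ω
    simp [S]
  rw [e1, ← Measure.map_apply ((hX b).prodMk hR) hS, hind3, Measure.prod_apply hS,
    lX b, lintegral_map (measurable_measure_prodMk_left hS) (by fun_prop)]
  have e3 : ∫⁻ z, P.map (fun ω (c : T) => X c ω)
        (Prod.mk (σ b * z) ⁻¹' S) ∂(frechet α)
      = ∫⁻ z, ENNReal.ofReal (Real.exp (-(B / s ^ α * z ^ (-α)))) ∂(frechet α) := by
    refine lintegral_congr_ae ?_
    filter_upwards [ae_frechet_pos] with z hz
    have hsz : u b * (σ b * z) = s * z := by rw [hsdef]; ring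
    rw [e2, hsz, measure_forall_mul_lt hα hX hind hσ lX hw _ (mul_pos hs hz),
      Real.mul_rpow hs.le hz.le, Real.rpow_neg hs.le, ← hB, ← mul_assoc, div_eq_mul_inv]
  rw [e3, lintegral_exp_frechet hα (by positivity), hW]
  refine ENNReal.ofReal_le_ofReal ?_
  have : 1 / (1 + B / s ^ α) = s ^ α / (s ^ α + B) := by
    field_simp
  rw [this]
  gcongr

omit [IsProbabilityMeasure P] in
lemma ae_eq_zero_of_frechet_zero {Y : Ω → ℝ} (hY : Measurable Y)
    (lY : P.map Y = (frechet α).map (fun z => 0 * z)) : ∀ᵐ ω ∂P, Y ω = 0 := by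
  have h : ∀ᵐ y ∂(P.map Y), y = 0 := by
    rw [lY]
    simp
  exact ae_of_ae_map hY.aemeasurable h

/-- If `∑ u^α σ^α` is at least `(1 - η) ∑ w^α σ^α`, there is a clear winner with probability at
least `1 - η`. -/
lemma measure_not_clearWinner_le (hα : 0 < α) (hX : ∀ b, Measurable (X b))
    (hX0 : ∀ b ω, 0 ≤ X b ω) (hind : iIndepFun X P)
    (hσ : ∀ b, 0 ≤ σ b) (lX : ∀ b, P.map (X b) = (frechet α).map (fun z => σ b * z))
    (hu : ∀ b, 0 ≤ u b) (huw : ∀ b, u b ≤ w b) {η : ℝ}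
    (h : (1 - η) * ∑ b, (w b * σ b) ^ α ≤ ∑ b, (u b * σ b) ^ α) :
    P {ω | ¬ ClearWinner u w (fun b => X b ω)} ≤ ENNReal.ofReal η := by
  have hw : ∀ b, 0 ≤ w b := fun b => (hu b).trans (huw b)
  have hterm : ∀ b, 0 ≤ (w b * σ b) ^ α :=
    fun b => Real.rpow_nonneg (mul_nonneg (hw b) (hσ b)) _
  have huterm : ∀ b, 0 ≤ (u b * σ b) ^ α :=
    fun b => Real.rpow_nonneg (mul_nonneg (hu b) (hσ b)) _
  -- If the total weight is zero, all entries vanish a.s. and the first alternative of `ClearWinner`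
  -- holds.
  rcases (Finset.sum_nonneg fun b (_ : b ∈ Finset.univ) => hterm b).eq_or_lt with hW | hW
  · have hz : ∀ b, w b * σ b = 0 := by
      intro b
      have := (Finset.sum_eq_zero_iff_of_nonneg fun b _ => hterm b).1 hW.symm b (Finset.mem_univ b)
      rwa [Real.rpow_eq_zero (mul_nonneg (hw b) (hσ b)) hα.ne'] at this
    have h0 : ∀ᵐ ω ∂P, ∀ b, w b * X b ω = 0 := by
      rw [ae_all_iff]
      intro b
      rcases mul_eq_zero.1 (hz b) with h | h
      · simp [h]
      · have := lX b
        rw [h] at this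
        filter_upwards [ae_eq_zero_of_frechet_zero (hX b) this] with ω hω
        simp [hω]
    have : P {ω | ¬ ClearWinner u w (fun b => X b ω)} = 0 := by
      rw [← ae_iff]
      filter_upwards [h0] with ω hω using Or.inl hω
    rw [this]
    exact zero_le
  · set G : β → Set Ω := fun b =>
      {ω | 0 < u b * X b ω ∧ ∀ c, c ≠ b → w c * X c ω < u b * X b ω} with hG
    have hGm : ∀ b, MeasurableSet (G b) := fun b => measurableSet_wins hX b
    -- Two winners would each strictly beat the other, because `u ≤ w` and `X ≥ 0`.
    have hdisj : Pairwise (fun b c => Disjoint (G b) (G c)) := by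
      intro b c hbc
      rw [Set.disjoint_left]
      intro ω hb hc
      have h1 := hb.2 c hbc.symm
      have h2 := hc.2 b hbc
      have h3 := mul_le_mul_of_nonneg_right (huw b) (hX0 b ω)
      have h4 := mul_le_mul_of_nonneg_right (huw c) (hX0 c ω)
      linarith
    have h1 : ENNReal.ofReal (1 - η) ≤ P (⋃ b, G b) := by
      rw [measure_iUnion hdisj hGm, tsum_fintype]
      calc ENNReal.ofReal (1 - η)
          ≤ ENNReal.ofReal (∑ b, (u b * σ b) ^ α / ∑ c, (w c * σ c) ^ α) := by
            refine ENNReal.ofReal_le_ofReal ?_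
            rw [← Finset.sum_div, le_div_iff₀ hW]
            exact h
        _ = ∑ b, ENNReal.ofReal ((u b * σ b) ^ α / ∑ c, (w c * σ c) ^ α) :=
            ENNReal.ofReal_sum_of_nonneg fun b _ => div_nonneg (huterm b) hW.le
        _ ≤ ∑ b, P (G b) :=
            Finset.sum_le_sum fun b _ => le_measure_wins hα hX hind hσ lX hu huw b
    have h2 : {ω | ¬ ClearWinner u w (fun b => X b ω)} ⊆ (⋃ b, G b)ᶜ := by
      intro ω hω hG'
      obtain ⟨b, hb⟩ := Set.mem_iUnion.1 hG'
      exact hω (Or.inr ⟨b, hb⟩)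
    calc P {ω | ¬ ClearWinner u w (fun b => X b ω)} ≤ P (⋃ b, G b)ᶜ := measure_mono h2
      _ = 1 - P (⋃ b, G b) := prob_compl_eq_one_sub (MeasurableSet.iUnion hGm)
      _ ≤ 1 - ENNReal.ofReal (1 - η) := tsub_le_tsub_left h1 _
      _ ≤ ENNReal.ofReal η := by
        rw [tsub_le_iff_right, ← ENNReal.ofReal_one]
        refine le_trans (ENNReal.ofReal_le_ofReal ?_) ENNReal.ofReal_add_le
        linarith

end competition

/-! ### Deterministic consequences of a clear winner -/

section argmax

variable {d : ℕ} {f : Vec d → ℝ} {β : Type*}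

/-- `y` is zero or one of the `x b`, and its loss is maximal. -/
def IsArgmax (f : Vec d → ℝ) (x : β → Vec d) (y : Vec d) : Prop :=
  (y = 0 ∨ ∃ b, y = x b) ∧ ∀ b, f (x b) ≤ f y

lemma IsLossFunction.map_smul (hf : IsLossFunction f) (c : ℝ≥0) (x : Vec d) :
    f ((c : ℝ) • x) = c * f x := hf.homogeneous _ _ c.2

lemma IsArgmax.eq_of_lt (hf : IsLossFunction f) {v : β → ℝ≥0} {x : β → Vec d} {y : Vec d}
    (hy : IsArgmax f (fun b => (v b : ℝ) • x b) y) {t : ℝ} (ht : 0 ≤ t) {b : β} (hb : t < f y)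
    (h : ∀ c, c ≠ b → v c * f (x c) ≤ t) : y = (v b : ℝ) • x b := by
  rcases hy.1 with rfl | ⟨c, hc⟩
  · rw [hf.map_zero] at hb
    linarith
  · by_cases hcb : c = b
    · rw [hc, hcb]
    · have := h c hcb
      rw [hc, hf.map_smul] at hb
      linarith

lemma IsArgmax.eq_zero {x : β → Vec d} {y : Vec d}
    (hy : IsArgmax f x y) (h : ∀ b, x b = 0) : y = 0 := by
  rcases hy.1 with rfl | ⟨c, hc⟩
  · rfl
  · rw [hc, h]

lemma smul_eq_zero_of_le (hf : IsLossFunction f) {u w : ℝ≥0} (huw : u ≤ w) {x : Vec d}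
    (h : (w : ℝ) * f x = 0) : (u : ℝ) • x = 0 := by
  rcases mul_eq_zero.1 h with h | h
  · have : w = 0 := by exact_mod_cast h
    have : u = 0 := by simpa [this] using huw
    simp [this]
  · simp [(hf.eq_zero_iff x).1 h]

lemma IsArgmax.eq_of_clearWinner (hf : IsLossFunction f) {w : β → ℝ≥0} {x : β → Vec d}
    {y y' : Vec d} (hy : IsArgmax f (fun b => (w b : ℝ) • x b) y)
    (hy' : IsArgmax f (fun b => (w b : ℝ) • x b) y')
    (h : ClearWinner (fun b => (w b : ℝ)) (fun b => (w b : ℝ)) (fun b => f (x b))) : y = y' := by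
  rcases h with h | ⟨b, hb, h⟩
  · have h0 : ∀ b, (w b : ℝ) • x b = 0 := fun b => smul_eq_zero_of_le hf le_rfl (h b)
    rw [hy.eq_zero h0, hy'.eq_zero h0]
  · have key : ∀ z, IsArgmax f (fun b => (w b : ℝ) • x b) z → z = (w b : ℝ) • x b := by
      intro z hz
      rcases hz.1 with rfl | ⟨c, hc⟩
      · have := hz.2 b
        rw [hf.map_smul, hf.map_zero] at this
        linarith
      · by_cases hcb : c = b
        · rw [hc, hcb]
        · have h1 := hz.2 b
          have h2 := h c hcb
          rw [hc, hf.map_smul, hf.map_smul] at h1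
          linarith
    rw [key y hy, key y' hy']

-- A clear winner `b` of the truncated race is the argmax in both races, so `y` and `z` are
-- multiples of the same `x b` with ratio `ρ = u b / w b`. The truncation ensures that only a `b`
-- with `ρ ≥ 1 - δ` can win.
open Classical in
lemma IsArgmax.exists_smul_eq (hf : IsLossFunction f) {u w : β → ℝ≥0} {x : β → Vec d}
    {y z : Vec d} (hy : IsArgmax f (fun b => (u b : ℝ) • x b) y)
    (hz : IsArgmax f (fun b => (w b : ℝ) • x b) z) (huw : ∀ b, u b ≤ w b) {δ : ℝ} (hδ : 0 ≤ δ)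
    (h : ClearWinner (fun b => if (1 - δ) * (w b : ℝ) ≤ u b then (u b : ℝ) else 0)
      (fun b => (w b : ℝ)) (fun b => f (x b))) :
    ∃ ρ : ℝ, 1 - δ ≤ ρ ∧ ρ ≤ 1 ∧ y = ρ • z := by
  rcases h with h | ⟨b, hb, h⟩
  · have h1 : y = 0 := hy.eq_zero fun b => smul_eq_zero_of_le hf (huw b) (h b)
    have h2 : z = 0 := hz.eq_zero fun b => smul_eq_zero_of_le hf le_rfl (h b)
    exact ⟨1, by linarith, le_rfl, by rw [h1, h2, smul_zero]⟩
  · dsimp only at hb h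
    split_ifs at hb h with hδb
    swap
    · simp at hb
    have huw' : (u b : ℝ) ≤ w b := by exact_mod_cast huw b
    have hub : (0 : ℝ) < u b := lt_of_le_of_ne (u b).2 fun h => by rw [← h] at hb; simp at hb
    have hwb : (0 : ℝ) < w b := hub.trans_le huw'
    have hfx := hf.nonneg
    have hy' : y = (u b : ℝ) • x b := by
      rcases hy.1 with rfl | ⟨c, hc⟩
      · have := hy.2 b
        rw [hf.map_smul, hf.map_zero] at this
        linarith
      · by_cases hcb : c = b
        · rw [hc, hcb]
        · have h1 := hy.2 b
          have h2 := h c hcb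
          have h3 : (u c : ℝ) ≤ w c := by exact_mod_cast huw c
          rw [hc, hf.map_smul, hf.map_smul] at h1
          have := mul_le_mul_of_nonneg_right h3 (hfx (x c))
          linarith
    have hz' : z = (w b : ℝ) • x b := by
      have hle := mul_le_mul_of_nonneg_right huw' (hfx (x b))
      rcases hz.1 with rfl | ⟨c, hc⟩
      · have := hz.2 b
        rw [hf.map_smul, hf.map_zero] at this
        linarith
      · by_cases hcb : c = b
        · rw [hc, hcb]
        · have h1 := hz.2 b
          have h2 := h c hcb
          rw [hc, hf.map_smul, hf.map_smul] at h1
          linarith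
    refine ⟨u b / w b, by rwa [le_div_iff₀ hwb], by rwa [div_le_one hwb], ?_⟩
    rw [hy', hz', smul_smul, div_mul_cancel₀ _ hwb.ne']

/-- The winner's handicap puts every other entry below `(1 - δ) * f z`, so an argmax with larger
loss must be a multiple of the winning `x b`. The last alternative is parallelism written without
division. -/
lemma IsArgmax.le_or_le_or_smul_eq (hf : IsLossFunction f) {u v : β → ℝ≥0} {x : β → Vec d}
    {y y' z : Vec d} (hy : IsArgmax f (fun b => (u b : ℝ) • x b) y)
    (hy' : IsArgmax f (fun b => (v b : ℝ) • x b) y')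
    (hz : IsArgmax f (fun b => ((u b ⊔ v b : ℝ≥0) : ℝ) • x b) z) {δ : ℝ}
    (h : ClearWinner (fun b => (1 - δ) * ((u b ⊔ v b : ℝ≥0) : ℝ))
      (fun b => ((u b ⊔ v b : ℝ≥0) : ℝ)) (fun b => f (x b))) :
    f y ≤ (1 - δ) * f z ∨ f y' ≤ (1 - δ) * f z ∨ f y' • y = f y • y' := by
  rcases h with h | ⟨b, hb, h⟩
  · have h1 : y = 0 := hy.eq_zero fun b => smul_eq_zero_of_le hf le_sup_left (h b)
    exact Or.inr (Or.inr (by rw [h1, hf.map_zero, smul_zero, zero_smul]))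
  · have hzb : ((u b ⊔ v b : ℝ≥0) : ℝ) * f (x b) ≤ f z := by
      have := hz.2 b
      rwa [hf.map_smul] at this
    have hw0 : 0 ≤ ((u b ⊔ v b : ℝ≥0) : ℝ) * f (x b) :=
      mul_nonneg (NNReal.coe_nonneg _) (hf.nonneg _)
    have hδ1 : 0 < 1 - δ := by
      by_contra hcon
      rw [mul_assoc] at hb
      have := mul_nonpos_of_nonpos_of_nonneg (not_lt.1 hcon) hw0
      linarith
    have ht : (1 - δ) * ((u b ⊔ v b : ℝ≥0) : ℝ) * f (x b) ≤ (1 - δ) * f z := by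
      rw [mul_assoc]
      exact mul_le_mul_of_nonneg_left hzb hδ1.le
    by_cases h1 : f y ≤ (1 - δ) * f z
    · exact Or.inl h1
    by_cases h2 : f y' ≤ (1 - δ) * f z
    · exact Or.inr (Or.inl h2)
    refine Or.inr (Or.inr ?_)
    have e1 := hy.eq_of_lt hf hb.le (ht.trans_lt (not_le.1 h1)) fun c hc => by
      refine le_trans (mul_le_mul_of_nonneg_right ?_ (hf.nonneg _)) (h c hc).le
      exact_mod_cast le_sup_left
    have e2 := hy'.eq_of_lt hf hb.le (ht.trans_lt (not_le.1 h2)) fun c hc => by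
      refine le_trans (mul_le_mul_of_nonneg_right ?_ (hf.nonneg _)) (h c hc).le
      exact_mod_cast le_sup_right
    rw [e1, e2, hf.map_smul, hf.map_smul, smul_smul, smul_smul]
    congr 1
    ring

lemma IsArgmax.fJoin (hf : IsLossFunction f) {u v : β → ℝ≥0} {x : β → Vec d}
    {y y' : Vec d} (hy : IsArgmax f (fun b => (u b : ℝ) • x b) y)
    (hy' : IsArgmax f (fun b => (v b : ℝ) • x b) y') :
    IsArgmax f (fun b => ((u b ⊔ v b : ℝ≥0) : ℝ) • x b) (fJoin f y y') := by
  have hle : ∀ b, f (((u b ⊔ v b : ℝ≥0) : ℝ) • x b) ≤ f (ImplicitExtremal.fJoin f y y') := by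
    intro b
    rw [apply_fJoin f]
    rcases le_total (u b) (v b) with h | h
    · rw [sup_eq_right.2 h]
      exact (hy'.2 b).trans (le_max_right _ _)
    · rw [sup_eq_left.2 h]
      exact (hy.2 b).trans (le_max_left _ _)
  -- If the join is `a • x b` with `a` at most the larger weight, maximality of its loss forces `a`
  -- to equal that weight, unless `x b = 0`.
  have key : ∀ b (a : ℝ≥0), a ≤ u b ⊔ v b →
      ImplicitExtremal.fJoin f y y' = (a : ℝ) • x b →
      ImplicitExtremal.fJoin f y y' = ((u b ⊔ v b : ℝ≥0) : ℝ) • x b := by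
    intro b a ha h
    by_cases hx : x b = 0
    · simpa [hx] using h
    have h1 := hle b
    have hpos : 0 < f (x b) :=
      lt_of_le_of_ne (hf.nonneg _) fun h => hx ((hf.eq_zero_iff _).1 h.symm)
    rw [h, hf.map_smul, hf.map_smul, mul_le_mul_iff_left₀ hpos] at h1
    have : a = u b ⊔ v b := le_antisymm ha (by exact_mod_cast h1)
    rw [h, this]
  refine ⟨?_, hle⟩
  rcases fJoin_eq_or f y y' with h | h
  · rcases hy.1 with h0 | ⟨b, hb⟩
    · exact Or.inl (h.trans h0)
    · exact Or.inr ⟨b, key b _ le_sup_left (h.trans hb)⟩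
  · rcases hy'.1 with h0 | ⟨b, hb⟩
    · exact Or.inl (h.trans h0)
    · exact Or.inr ⟨b, key b _ le_sup_right (h.trans hb)⟩

end argmax

/-! ### Cells, simple functions and common refinements -/

/-- A family of disjoint measurable sets of finite measure. -/
structure Cells {E : Type*} [MeasurableSpace E] (m : Measure E) (β : Type*) where
  cell : β → Set E
  measurableSet_cell : ∀ b, MeasurableSet (cell b)
  measure_cell_lt_top : ∀ b, m (cell b) < ∞
  disjoint_cell : Pairwise (fun b c => Disjoint (cell b) (cell c))

section cells

variable {E : Type*} [MeasurableSpace E] {m : Measure E} {β : Type*}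

lemma Cells.eq_of_mem (C : Cells m β) {b c : β} {s : E} (hb : s ∈ C.cell b) (hc : s ∈ C.cell c) :
    b = c := by
  by_contra h
  exact Set.disjoint_left.1 (C.disjoint_cell h) hb hc

/-- The scale `m(C_b)^{1/α}` of a cell. -/
noncomputable def Cells.scale (C : Cells m β) (α : ℝ) (b : β) : ℝ :=
  (m (C.cell b)).toReal ^ (1 / α)

lemma Cells.scale_nonneg (C : Cells m β) (α : ℝ) (b : β) : 0 ≤ C.scale α b := by
  unfold Cells.scale
  positivity

lemma Cells.scale_rpow (C : Cells m β) {α : ℝ} (hα : 0 < α) (b : β) :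
    C.scale α b ^ α = (m (C.cell b)).toReal := by
  unfold Cells.scale
  rw [← Real.rpow_mul ENNReal.toReal_nonneg, one_div_mul_cancel hα.ne', Real.rpow_one]

/-- Every cell of `r` is a union of cells of `C`, and `r` takes the value `u b` on `C_b`. -/
structure SimpleRep.IsRefinedBy (r : SimpleRep m) (C : Cells m β) (u : β → ℝ≥0) : Prop where
  cell_eq : ∀ j, ∃ J : Set β, r.cell j = ⋃ b ∈ J, C.cell b
  toFun_eq : ∀ b, ∀ s ∈ C.cell b, r.toFun s = u b

namespace SimpleRep

lemma toFun_of_mem (r : SimpleRep m) {j : Fin (r.k + 1)} {s : E} (hs : s ∈ r.cell j) :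
    r.toFun s = r.coef j := by
  unfold toFun
  rw [Finset.sum_eq_single j]
  · simp [hs]
  · intro i _ hij
    exact Set.indicator_of_notMem (fun h => Set.disjoint_left.1 (r.disjoint_cell hij) h hs) _
  · simp

lemma toFun_of_notMem (r : SimpleRep m) {s : E} (hs : ∀ j, s ∉ r.cell j) : r.toFun s = 0 := by
  unfold toFun
  exact Finset.sum_eq_zero fun j _ => Set.indicator_of_notMem (hs j) _

lemma measurable_toFun (r : SimpleRep m) : Measurable r.toFun := by
  unfold toFun
  exact Finset.measurable_sum _ fun j _ => measurable_const.indicator (r.measurableSet_cell j)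

/-- The cells of a simple function. -/
def cells (r : SimpleRep m) : Cells m (Fin (r.k + 1)) where
  cell := r.cell
  measurableSet_cell := r.measurableSet_cell
  measure_cell_lt_top := r.measure_cell_lt_top
  disjoint_cell := r.disjoint_cell

lemma isRefinedBy_cells (r : SimpleRep m) : r.IsRefinedBy r.cells r.coef where
  cell_eq j := ⟨{j}, by simp [cells]⟩
  toFun_eq _ _ hs := r.toFun_of_mem hs

lemma IsRefinedBy.toFun_of_notMem {r : SimpleRep m} {C : Cells m β} {u : β → ℝ≥0}
    (h : r.IsRefinedBy C u) {s : E} (hs : ∀ b, s ∉ C.cell b) : r.toFun s = 0 := by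
  refine r.toFun_of_notMem fun j hj => ?_
  obtain ⟨J, hJ⟩ := h.cell_eq j
  rw [hJ] at hj
  simp only [Set.mem_iUnion] at hj
  obtain ⟨b, _, hb⟩ := hj
  exact hs b hb

/-- The `α`-th power of the norm of a simple function. -/
noncomputable def powNorm (α : ℝ) (r : SimpleRep m) : ℝ :=
  (∫⁻ s, (r.toFun s : ℝ≥0∞) ^ α ∂m).toReal

lemma IsRefinedBy.lintegral_eq [Fintype β] {r : SimpleRep m} {C : Cells m β} {u : β → ℝ≥0}
    (h : r.IsRefinedBy C u) {α : ℝ} (hα : 0 < α) :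
    ∫⁻ s, (r.toFun s : ℝ≥0∞) ^ α ∂m = ∑ b, (u b : ℝ≥0∞) ^ α * m (C.cell b) := by
  have e : ∀ s, (r.toFun s : ℝ≥0∞) ^ α
      = ∑ b, (C.cell b).indicator (fun _ => (u b : ℝ≥0∞) ^ α) s := by
    intro s
    by_cases hs : ∃ b, s ∈ C.cell b
    · obtain ⟨b, hb⟩ := hs
      rw [h.toFun_eq b s hb, Finset.sum_eq_single b]
      · simp [hb]
      · intro c _ hcb
        exact Set.indicator_of_notMem (fun hc => hcb (C.eq_of_mem hc hb)) _
      · simp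
    · push Not at hs
      rw [h.toFun_of_notMem hs, Finset.sum_eq_zero]
      · simp [hα]
      · exact fun b _ => Set.indicator_of_notMem (hs b) _
  simp_rw [e]
  rw [lintegral_finsetSum _ fun b _ => measurable_const.indicator (C.measurableSet_cell b)]
  refine Finset.sum_congr rfl fun b _ => ?_
  rw [lintegral_indicator_const (C.measurableSet_cell b)]

lemma IsRefinedBy.powNorm_eq [Fintype β] {r : SimpleRep m} {C : Cells m β} {u : β → ℝ≥0}
    (h : r.IsRefinedBy C u) {α : ℝ} (hα : 0 < α) :
    r.powNorm α = ∑ b, ((u b : ℝ) * C.scale α b) ^ α := by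
  unfold powNorm
  rw [h.lintegral_eq hα, ENNReal.toReal_sum]
  · refine Finset.sum_congr rfl fun b _ => ?_
    rw [Real.mul_rpow (NNReal.coe_nonneg _) (C.scale_nonneg α b), C.scale_rpow hα,
      ENNReal.toReal_mul, ← ENNReal.toReal_rpow, ENNReal.coe_toReal]
  · intro b _
    exact ENNReal.mul_ne_top (ENNReal.rpow_ne_top_of_nonneg hα.le ENNReal.coe_ne_top)
      (C.measure_cell_lt_top b).ne

/-- An enumeration of a nonempty finite type. -/
noncomputable def finEquiv (β : Type*) [Fintype β] [Nonempty β] :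
    Fin (Fintype.card β - 1 + 1) ≃ β :=
  (finCongr (Nat.sub_add_cancel Fintype.card_pos)).trans (Fintype.equivFin β).symm

/-- The simple function with value `w b` on the cell `C_b`. -/
noncomputable def ofCells [Fintype β] [Nonempty β] (C : Cells m β) (w : β → ℝ≥0) : SimpleRep m where
  k := Fintype.card β - 1
  coef j := w (finEquiv β j)
  cell j := C.cell (finEquiv β j)
  measurableSet_cell _ := C.measurableSet_cell _
  measure_cell_lt_top _ := C.measure_cell_lt_top _
  disjoint_cell _ _ hij := C.disjoint_cell ((finEquiv β).injective.ne hij)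

lemma isRefinedBy_ofCells [Fintype β] [Nonempty β] (C : Cells m β) (w : β → ℝ≥0) :
    (ofCells C w).IsRefinedBy C w where
  cell_eq j := ⟨{finEquiv β j}, by rw [Set.biUnion_singleton]; rfl⟩
  toFun_eq b s hs := by
    obtain ⟨j, rfl⟩ := (finEquiv β).surjective b
    exact (ofCells C w).toFun_of_mem (j := j) hs

/-- The cells are the atoms of both families, indexed by pairs of membership patterns. Intersecting
with the union of all cells keeps measures finite and discards only points where both functions
vanish. -/
lemma exists_common_refinement (r r' : SimpleRep m) :
    ∃ (β : Type) (_ : Fintype β) (_ : Nonempty β) (C : Cells m β) (u u' : β → ℝ≥0),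
      r.IsRefinedBy C u ∧ r'.IsRefinedBy C u' := by
  classical
  let C : Cells m (Set (Fin (r.k + 1)) × Set (Fin (r'.k + 1))) :=
    { cell := fun b => {s | (∀ j, s ∈ r.cell j ↔ j ∈ b.1) ∧ ∀ j, s ∈ r'.cell j ↔ j ∈ b.2} ∩
        ((⋃ j, r.cell j) ∪ ⋃ j, r'.cell j)
      measurableSet_cell := by
        intro b
        have h1 := r.measurableSet_cell
        have h2 := r'.measurableSet_cell
        refine MeasurableSet.inter (MeasurableSet.inter ?_ ?_)
          ((MeasurableSet.iUnion h1).union (MeasurableSet.iUnion h2))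
        · change MeasurableSet {s | ∀ j, s ∈ r.cell j ↔ j ∈ b.1}
          rw [Set.ofPred_forall]
          exact MeasurableSet.iInter fun j => (h1 j).iff (MeasurableSet.const _)
        · change MeasurableSet {s | ∀ j, s ∈ r'.cell j ↔ j ∈ b.2}
          rw [Set.ofPred_forall]
          exact MeasurableSet.iInter fun j => (h2 j).iff (MeasurableSet.const _)
      measure_cell_lt_top := by
        intro b
        refine (measure_mono Set.inter_subset_right).trans_lt ?_
        refine (measure_union_le _ _).trans_lt (ENNReal.add_lt_top.2 ⟨?_, ?_⟩)
        · exact (measure_iUnion_fintype_le _ _).trans_lt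
            (ENNReal.sum_lt_top.2 fun j _ => r.measure_cell_lt_top j)
        · exact (measure_iUnion_fintype_le _ _).trans_lt
            (ENNReal.sum_lt_top.2 fun j _ => r'.measure_cell_lt_top j)
      disjoint_cell := by
        intro b c hbc
        rw [Set.disjoint_left]
        rintro s ⟨⟨h1, h2⟩, _⟩ ⟨⟨h3, h4⟩, _⟩
        refine hbc (Prod.ext (Set.ext fun j => ?_) (Set.ext fun j => ?_))
        · exact (h1 j).symm.trans (h3 j)
        · exact (h2 j).symm.trans (h4 j) }
  -- On a nonempty atom at most one coefficient contributes to each sum. On an empty atom the value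
  -- is irrelevant.
  refine ⟨_, inferInstance, inferInstance, C, fun b => ∑ j, if j ∈ b.1 then r.coef j else 0,
    fun b => ∑ j, if j ∈ b.2 then r'.coef j else 0, ⟨fun j => ⟨{b | j ∈ b.1}, ?_⟩, ?_⟩,
    ⟨fun j => ⟨{b | j ∈ b.2}, ?_⟩, ?_⟩⟩
  · ext s
    simp only [Set.mem_iUnion, Set.mem_ofPred_eq]
    constructor
    · intro hs
      refine ⟨({j | s ∈ r.cell j}, {j | s ∈ r'.cell j}), hs, ⟨fun _ => Iff.rfl, fun _ => Iff.rfl⟩,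
        Or.inl (Set.mem_iUnion.2 ⟨j, hs⟩)⟩
    · rintro ⟨b, hb, ⟨h1, _⟩, _⟩
      exact (h1 j).2 hb
  · rintro b s ⟨⟨h1, _⟩, _⟩
    unfold toFun
    simp [Set.indicator_apply, h1]
  · ext s
    simp only [Set.mem_iUnion, Set.mem_ofPred_eq]
    constructor
    · intro hs
      refine ⟨({j | s ∈ r.cell j}, {j | s ∈ r'.cell j}), hs, ⟨fun _ => Iff.rfl, fun _ => Iff.rfl⟩,
        Or.inr (Set.mem_iUnion.2 ⟨j, hs⟩)⟩
    · rintro ⟨b, hb, ⟨_, h1⟩, _⟩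
      exact (h1 j).2 hb
  · rintro b s ⟨⟨_, h1⟩, _⟩
    unfold toFun
    simp [Set.indicator_apply, h1]

end SimpleRep

end cells

/-! ### Sup-measures on cells -/

section supMeasure

variable {d : ℕ} {f : Vec d → ℝ} {α : ℝ} {κ : Measure {x : Vec d // f x = 1}}
  {E : Type*} [MeasurableSpace E] {m : Measure E}
  {Ω : Type*} [MeasurableSpace Ω] {P : Measure Ω}
  {M : Set E → Ω → Vec d} {β : Type*}

namespace IsImplicitFrechetSupMeasure

/-- Scale zero makes the law a Dirac mass at the origin. This allows padding finite families by `∅`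
and ignoring empty cells. -/
lemma ae_empty [IsProbabilityMeasure κ]
    (hM : IsImplicitFrechetSupMeasure f α κ m P M) (hα : 0 < α) :
    ∀ᵐ ω ∂P, M ∅ ω = 0 := by
  have h := (hasImplicitFrechetLaw_iff hα).1 (hM.law ∅ MeasurableSet.empty (by simp))
  rw [measure_empty, ENNReal.toReal_zero, Real.zero_rpow (by positivity), implFrechet_zero] at h
  have hm : Measurable (M ∅) := hM.measurable ∅ MeasurableSet.empty (by simp)
  refine ae_of_ae_map (p := fun x => x = 0) hm.aemeasurable ?_
  rw [h]
  simp

lemma map_cell (hM : IsImplicitFrechetSupMeasure f α κ m P M) (hα : 0 < α) (C : Cells m β)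
    (b : β) : P.map (M (C.cell b)) = implFrechet α κ (C.scale α b) :=
  (hasImplicitFrechetLaw_iff hα).1 (hM.law _ (C.measurableSet_cell b) (C.measure_cell_lt_top b))

lemma measurable_cell (hM : IsImplicitFrechetSupMeasure f α κ m P M) (C : Cells m β) (b : β) :
    Measurable (M (C.cell b)) :=
  hM.measurable _ (C.measurableSet_cell b) (C.measure_cell_lt_top b)

lemma iIndepFun_cell (hM : IsImplicitFrechetSupMeasure f α κ m P M) [Fintype β] (C : Cells m β) :
    iIndepFun (fun b => M (C.cell b)) P := by
  have h := hM.indep (Fintype.card β) (fun j => C.cell ((Fintype.equivFin β).symm j))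
    (fun _ => C.measurableSet_cell _) (fun _ => C.measure_cell_lt_top _)
    (fun _ _ hij => C.disjoint_cell ((Fintype.equivFin β).symm.injective.ne hij))
  exact (iIndepFun_precomp_of_bijective (f := fun b => M (C.cell b))
    (Fintype.equivFin β).symm.bijective).1 h

/-- Finite maxitivity: a.s., the value of `M` at a finite union of cells is the maximum of the
values at the cells. -/
lemma ae_biUnion [IsProbabilityMeasure κ]
    (hM : IsImplicitFrechetSupMeasure f α κ m P M) (hf : IsLossFunction f)
    (hα : 0 < α) [Fintype β] (C : Cells m β) (J : Set β) :
    ∀ᵐ ω ∂P, (M (⋃ b ∈ J, C.cell b) ω = 0 ∨ ∃ b ∈ J, M (⋃ b ∈ J, C.cell b) ω = M (C.cell b) ω) ∧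
      ∀ b ∈ J, f (M (C.cell b) ω) ≤ f (M (⋃ b ∈ J, C.cell b) ω) := by
  classical
  let e := Fintype.equivFin β
  -- The cells selected by `J`, listed as a sequence and padded by `∅`, so that countable maxitivity
  -- applies.
  let A : ℕ → Set E := fun n => {s | ∃ b ∈ J, (e b : ℕ) = n ∧ s ∈ C.cell b}
  have hinj : ∀ b c : β, (e b : ℕ) = e c → b = c := fun b c h => e.injective (Fin.ext h)
  have hA1 : ∀ b ∈ J, A (e b) = C.cell b := by
    intro b hb
    ext s
    constructor
    · rintro ⟨c, _, hc, hs⟩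
      rwa [hinj c b hc] at hs
    · exact fun hs => ⟨b, hb, rfl, hs⟩
  have hA2 : ∀ n, (∃ b ∈ J, A n = C.cell b) ∨ A n = ∅ := by
    intro n
    by_cases h : ∃ b ∈ J, (e b : ℕ) = n
    · obtain ⟨b, hb, rfl⟩ := h
      exact Or.inl ⟨b, hb, hA1 b hb⟩
    · refine Or.inr (Set.eq_empty_of_forall_notMem ?_)
      rintro s ⟨b, hb, hn, _⟩
      exact h ⟨b, hb, hn⟩
  have hU : ⋃ n, A n = ⋃ b ∈ J, C.cell b := by
    ext s
    simp only [Set.mem_iUnion]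
    constructor
    · rintro ⟨n, b, hb, _, hs⟩
      exact ⟨b, hb, hs⟩
    · rintro ⟨b, hb, hs⟩
      exact ⟨_, b, hb, rfl, hs⟩
  have hfin : m (⋃ n, A n) < ∞ := by
    rw [hU]
    refine (measure_mono (Set.iUnion₂_subset_iUnion _ _)).trans_lt ?_
    exact (measure_iUnion_fintype_le _ _).trans_lt
      (ENNReal.sum_lt_top.2 fun j _ => C.measure_cell_lt_top j)
  have hdis : Pairwise (fun i j => Disjoint (A i) (A j)) := by
    intro i j hij
    rw [Set.disjoint_left]
    rintro s ⟨b, _, rfl, hb⟩ ⟨c, _, rfl, hc⟩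
    exact hij (by rw [C.eq_of_mem hb hc])
  have hmeas : ∀ n, MeasurableSet (A n) := by
    intro n
    rcases hA2 n with ⟨b, _, h⟩ | h
    · rw [h]; exact C.measurableSet_cell b
    · rw [h]; exact MeasurableSet.empty
  have hlt : ∀ n, m (A n) < ∞ := fun n =>
    (measure_mono (Set.subset_iUnion A n)).trans_lt hfin
  filter_upwards [hM.sup A hmeas hlt hdis hfin, hM.ae_empty hα] with ω hω h0
  rw [hU] at hω
  refine ⟨?_, fun b hb => ?_⟩
  · obtain ⟨n, hn⟩ := hω.2
    rcases hA2 n with ⟨b, hb, h⟩ | h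
    · exact Or.inr ⟨b, hb, by rw [hn, h]⟩
    · exact Or.inl (by rw [hn, h, h0])
  -- The infinite maximum is a limit. By continuity of `f` it keeps the lower bounds on the loss
  -- that hold for the finite maxima.
  · have hlim := (hf.continuous.tendsto _).comp hω.1
    refine ge_of_tendsto hlim ?_
    filter_upwards [eventually_ge_atTop (e b : ℕ)] with n hn
    have := le_apply_fMax f n (fun j => M (A j) ω) ⟨e b, by omega⟩
    rw [hA1 b hb] at this
    exact this

/-- By finite maxitivity the integral can be read off any refinement. This reduces comparisons of
simple integrals to weights on one common family of cells. -/
lemma ae_isArgmax_integral [IsProbabilityMeasure κ]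
    (hM : IsImplicitFrechetSupMeasure f α κ m P M) (hf : IsLossFunction f)
    (hα : 0 < α) [Fintype β] {C : Cells m β} {r : SimpleRep m} {u : β → ℝ≥0}
    (h : r.IsRefinedBy C u) :
    ∀ᵐ ω ∂P, IsArgmax f (fun b => (u b : ℝ) • M (C.cell b) ω) (r.integral f M ω) := by
  choose J hJ using h.cell_eq
  have h1 := ae_all_iff.2 fun j => hM.ae_biUnion hf hα C (J j)
  filter_upwards [h1, hM.ae_empty hα] with ω hω h0
  -- On an empty cell the value `u b` is unconstrained, but there `M` vanishes a.s., so no harm is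
  -- done.
  have hne : ∀ b, M (C.cell b) ω ≠ 0 → ∃ s, s ∈ C.cell b := by
    intro b hb
    by_contra hcon
    rw [Set.eq_empty_of_forall_notMem fun s hs => hcon ⟨s, hs⟩] at hb
    exact hb h0
  have hcoef : ∀ j, ∀ b ∈ J j, M (C.cell b) ω ≠ 0 → r.coef j = u b := by
    intro j b hb hb0
    obtain ⟨s, hs⟩ := hne b hb0
    rw [← h.toFun_eq b s hs, r.toFun_of_mem (j := j)]
    rw [hJ]
    exact Set.mem_biUnion hb hs
  refine ⟨?_, fun b => ?_⟩
  · obtain ⟨j, hj⟩ := exists_fMax_eq f r.k (fun j => (r.coef j : ℝ) • M (r.cell j) ω)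
    change r.integral f M ω = _ at hj
    have hj1 := (hω j).1
    rw [← hJ] at hj1
    rcases hj1 with hz | ⟨b, hb, hz⟩
    · exact Or.inl (by rw [hj, hz, smul_zero])
    · by_cases hb0 : M (C.cell b) ω = 0
      · exact Or.inl (by rw [hj, hz, hb0, smul_zero])
      · exact Or.inr ⟨b, by rw [hj, hz, hcoef j b hb hb0]⟩
  · dsimp only
    by_cases hb0 : M (C.cell b) ω = 0
    · rw [hb0, smul_zero, hf.map_zero]
      exact hf.nonneg _
    obtain ⟨s, hs⟩ := hne b hb0
    by_cases hu : ∃ j, s ∈ r.cell j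
    · obtain ⟨j, hj⟩ := hu
      have hbJ : b ∈ J j := by
        rw [hJ] at hj
        simp only [Set.mem_iUnion] at hj
        obtain ⟨c, hc, hcs⟩ := hj
        rwa [C.eq_of_mem hs hcs]
      have h2 := (hω j).2 b hbJ
      rw [← hJ] at h2
      refine le_trans ?_ (le_apply_fMax f r.k (fun j => (r.coef j : ℝ) • M (r.cell j) ω) j)
      rw [hf.map_smul, hf.map_smul, hcoef j b hbJ hb0]
      exact mul_le_mul_of_nonneg_left h2 (NNReal.coe_nonneg _)
    · have : u b = 0 := by
        rw [← h.toFun_eq b s hs, r.toFun_of_notMem (not_exists.1 hu)]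
      rw [this, NNReal.coe_zero, zero_smul, hf.map_zero]
      exact hf.nonneg _

lemma measurable_integral (hM : IsImplicitFrechetSupMeasure f α κ m P M) (hf : IsLossFunction f)
    (r : SimpleRep m) : Measurable (r.integral f M) :=
  (measurable_fMax hf r.k).comp
    (measurable_pi_lambda _ fun j => (hM.measurable_cell r.cells j).const_smul (r.coef j : ℝ))

lemma map_integral [IsProbabilityMeasure κ] [IsProbabilityMeasure P]
    (hM : IsImplicitFrechetSupMeasure f α κ m P M) (hf : IsLossFunction f)
    (hα : 0 < α) (r : SimpleRep m) :
    P.map (r.integral f M) = implFrechet α κ (r.powNorm α ^ (1 / α)) := by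
  rw [r.isRefinedBy_cells.powNorm_eq hα]
  refine map_fMax_of_iIndepFun hf hα r.k (X := fun j ω => (r.coef j : ℝ) • M (r.cell j) ω)
    (fun j => (hM.measurable_cell r.cells j).const_smul (r.coef j : ℝ)) ?_
    (fun j => mul_nonneg (r.coef j).2 (r.cells.scale_nonneg α j)) fun j => ?_
  · exact (hM.iIndepFun_cell r.cells).comp (fun j x => (r.coef j : ℝ) • x)
      fun j => measurable_const_smul _
  · rw [← map_smul_implFrechet, ← hM.map_cell hα r.cells j,
      Measure.map_map (by fun_prop) (hM.measurable_cell r.cells j)]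
    rfl

lemma measure_not_clearWinner_cells_le [IsProbabilityMeasure κ] [IsProbabilityMeasure P]
    (hM : IsImplicitFrechetSupMeasure f α κ m P M)
    (hf : IsLossFunction f) (hα : 0 < α) [Fintype β] (C : Cells m β) {u w : β → ℝ}
    (hu : ∀ b, 0 ≤ u b) (huw : ∀ b, u b ≤ w b) {η : ℝ}
    (h : (1 - η) * ∑ b, (w b * C.scale α b) ^ α ≤ ∑ b, (u b * C.scale α b) ^ α) :
    P {ω | ¬ ClearWinner u w (fun b => f (M (C.cell b) ω))} ≤ ENNReal.ofReal η := by
  have hfm := hf.continuous.measurable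
  refine measure_not_clearWinner_le hα (X := fun b ω => f (M (C.cell b) ω))
    (fun b => hfm.comp (hM.measurable_cell C b)) (fun b ω => hf.nonneg _)
    ((hM.iIndepFun_cell C).comp (fun _ => f) fun _ => hfm) (C.scale_nonneg α) (fun b => ?_)
    hu huw h
  rw [← map_loss_implFrechet (κ := κ) hf (C.scale_nonneg α b), ← hM.map_cell hα C b,
    Measure.map_map hfm (hM.measurable_cell C b)]
  rfl

end IsImplicitFrechetSupMeasure

end supMeasure

/-! ### Cauchy sequences in probability -/

/-- Completeness of convergence in measure. -/
lemma exists_tendstoInMeasure_of_cauchy {Ω F : Type*} [MeasurableSpace Ω] {P : Measure Ω}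
    [IsFiniteMeasure P] [MetricSpace F] [CompleteSpace F] [MeasurableSpace F] [BorelSpace F]
    [SecondCountableTopology F] {X : ℕ → Ω → F} (hX : ∀ n, Measurable (X n))
    (hC : ∀ ε > 0, ∀ η : ℝ≥0∞, 0 < η → ∃ N, ∀ n ≥ N, ∀ k ≥ n,
      P {ω | ε ≤ dist (X n ω) (X k ω)} ≤ η) :
    ∃ Y : Ω → F, Measurable Y ∧ TendstoInMeasure P X atTop Y := by
  have hpow : ∀ i : ℕ, (0 : ℝ) < (1 / 2) ^ i := fun i => by positivity
  choose N hN using fun i : ℕ => hC ((1 / 2) ^ i) (hpow i) ((1 / 2) ^ i)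
    (ENNReal.pow_pos (by simp) i)
  -- The supremum dominates `N i`, and adding `i` makes the subsequence strictly increasing.
  -- Geometric errors then give a.s. convergence by Borel–Cantelli.
  let φ : ℕ → ℕ := fun i => (Finset.range (i + 1)).sup N + i
  have hφN : ∀ i, N i ≤ φ i := fun i =>
    (Finset.le_sup (f := N) (Finset.self_mem_range_succ i)).trans (Nat.le_add_right _ _)
  have hφmono : StrictMono φ := by
    refine strictMono_nat_of_lt_succ fun i => ?_
    have : (Finset.range (i + 1)).sup N ≤ (Finset.range (i + 1 + 1)).sup N :=
      Finset.sup_mono (by simp)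
    simp only [φ]
    omega
  have hBC : P (limsup (fun i => {ω | (1 / 2 : ℝ) ^ i ≤ dist (X (φ i) ω) (X (φ (i + 1)) ω)})
      atTop) = 0 := by
    refine measure_limsup_atTop_eq_zero (ne_top_of_le_ne_top ?_
      (ENNReal.tsum_le_tsum fun i =>
        hN i (φ i) (hφN i) (φ (i + 1)) (hφmono (Nat.lt_succ_self i)).le))
    rw [ENNReal.tsum_geometric]
    simp
  have hlim : ∀ᵐ ω ∂P, ∃ y, Tendsto (fun i => X (φ i) ω) atTop (𝓝 y) := by
    have h : ∀ᵐ ω ∂P, ω ∉ limsup (fun i =>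
        {ω | (1 / 2 : ℝ) ^ i ≤ dist (X (φ i) ω) (X (φ (i + 1)) ω)}) atTop :=
      measure_eq_zero_iff_ae_notMem.1 hBC
    filter_upwards [h] with ω hω
    rw [mem_limsup_iff_frequently_mem, not_frequently] at hω
    refine cauchySeq_tendsto_of_complete (cauchySeq_of_summable_dist ?_)
    refine Summable.of_norm_bounded_eventually_nat (g := fun i => (1 / 2 : ℝ) ^ i)
      summable_geometric_two ?_
    filter_upwards [hω] with i hi
    rw [Real.norm_of_nonneg dist_nonneg]
    exact (not_le.1 hi).le
  obtain ⟨Y, hY, hYlim⟩ := measurable_limit_of_tendsto_metrizable_ae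
    (fun i => (hX (φ i)).aemeasurable) hlim
  refine ⟨Y, hY, ?_⟩
  have hsub : TendstoInMeasure P (fun i => X (φ i)) atTop Y :=
    tendstoInMeasure_of_tendsto_ae (fun i => (hX (φ i)).aestronglyMeasurable) hYlim
  rw [tendstoInMeasure_iff_dist] at hsub ⊢
  intro ε hε
  rw [ENNReal.tendsto_atTop_zero]
  intro η hη
  have hη2 : 0 < η / 2 := ENNReal.half_pos hη.ne'
  obtain ⟨N₀, hN₀⟩ := hC (ε / 2) (by positivity) (η / 2) hη2
  obtain ⟨i₀, hi₀⟩ := (ENNReal.tendsto_atTop_zero.1 (hsub (ε / 2) (by positivity))) (η / 2) hη2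
  refine ⟨N₀, fun n hn => ?_⟩
  set i := max i₀ n
  have hni : n ≤ φ i := (le_max_right _ _).trans (hφmono.id_le i)
  calc P {ω | ε ≤ dist (X n ω) (Y ω)}
      ≤ P ({ω | ε / 2 ≤ dist (X n ω) (X (φ i) ω)} ∪ {ω | ε / 2 ≤ dist (X (φ i) ω) (Y ω)}) := by
        refine measure_mono fun ω hω => ?_
        by_contra hcon
        simp only [Set.mem_union, Set.mem_ofPred_eq, not_or, not_le] at hcon hω
        have := dist_triangle (X n ω) (X (φ i) ω) (Y ω)
        linarith [hcon.1, hcon.2]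
    _ ≤ _ := measure_union_le _ _
    _ ≤ η / 2 + η / 2 := add_le_add (hN₀ n hn _ hni) (hi₀ i (le_max_left _ _))
    _ = η := ENNReal.add_halves η

/-! ### Approximation of `L^α_+` by simple functions -/

section approximation

variable {E : Type*} [MeasurableSpace E] {m : Measure E} {α : ℝ}

/-- The zero level set may have infinite measure, so its cell is replaced by `∅`. The index `0` is
always included, which keeps the index type nonempty even for empty `E`. -/
lemma exists_simpleRep_toFun_eq (φ : SimpleFunc E ℝ≥0) (hφ : m (Function.support φ) < ∞) :
    ∃ r : SimpleRep m, r.toFun = φ := by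
  classical
  let C : Cells m (↥(insert 0 φ.range : Finset ℝ≥0)) :=
    { cell := fun b => if (b : ℝ≥0) = 0 then ∅ else φ ⁻¹' {(b : ℝ≥0)}
      measurableSet_cell := by
        intro b
        split_ifs
        · exact MeasurableSet.empty
        · exact φ.measurableSet_fiber _
      measure_cell_lt_top := by
        intro b
        split_ifs with h
        · simp
        · refine (measure_mono fun s hs => ?_).trans_lt hφ
          rw [Set.mem_preimage, Set.mem_singleton_iff] at hs
          rw [Function.mem_support, hs]
          exact h
      disjoint_cell := by
        intro b c hbc
        split_ifs
        · simp
        · simp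
        · simp
        · rw [Set.disjoint_left]
          intro s hb hc
          exact hbc (Subtype.ext (hb.symm.trans hc)) }
  have : Nonempty (↥(insert 0 φ.range : Finset ℝ≥0)) := ⟨⟨0, by simp⟩⟩
  have href := SimpleRep.isRefinedBy_ofCells C fun b => (b : ℝ≥0)
  refine ⟨SimpleRep.ofCells C fun b => (b : ℝ≥0), funext fun s => ?_⟩
  by_cases hs : φ s = 0
  · rw [hs]
    refine href.toFun_of_notMem fun b hb => ?_
    simp only [C] at hb
    split_ifs at hb with h
    · exact hb
    · exact h (hb.symm.trans hs)
  · exact href.toFun_eq ⟨φ s, by simp⟩ s (by simp [C, hs])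

/-- Functions in `L^α_+` are increasing limits of simple functions. -/
lemma MemLPlus.exists_increasesTo {g : E → ℝ≥0} (hα : 0 < α) (hg : MemLPlus α m g) :
    ∃ r : ℕ → SimpleRep m, IncreasesTo r g := by
  -- Approximating `g ^ α`, whose integral is finite, yields simple functions with supports of
  -- finite measure. The `1 / α`-th power then returns to `g`.
  set G : E → ℝ≥0∞ := fun s => (g s : ℝ≥0∞) ^ α with hG
  have hGm : Measurable G := hg.1.coe_nnreal_ennreal.pow_const α
  let φ : ℕ → SimpleFunc E ℝ≥0 := fun n =>
    (SimpleFunc.eapprox G n).map fun x => (x ^ (1 / α)).toNNReal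
  have hφ : ∀ n, m (Function.support (φ n)) < ∞ := by
    intro n
    refine (measure_mono ?_).trans_lt
      (measure_support_eapprox_lt_top hGm hg.2.ne n)
    intro s hs h0
    apply hs
    simp [φ, h0, hα.ne']
  choose r hr using fun n => exists_simpleRep_toFun_eq (φ n) (hφ n)
  have hfin : ∀ n s, (SimpleFunc.eapprox G n s) ^ (1 / α) ≠ ∞ := fun n s =>
    ENNReal.rpow_ne_top_of_nonneg (by positivity) (SimpleFunc.eapprox_lt_top G n s).ne
  refine ⟨r, fun s => ⟨fun n k hnk => ?_, ?_⟩⟩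
  · simp only [hr]
    exact ENNReal.toNNReal_mono (hfin k s)
      (ENNReal.rpow_le_rpow (SimpleFunc.monotone_eapprox G hnk s) (by positivity))
  · simp only [hr]
    have h1 := (SimpleFunc.tendsto_eapprox hGm s).ennrpow_const (1 / α)
    have h2 : G s ^ (1 / α) = g s := by
      rw [hG, ← ENNReal.rpow_mul, mul_one_div_cancel hα.ne', ENNReal.rpow_one]
    rw [h2] at h1
    exact (ENNReal.tendsto_toNNReal ENNReal.coe_ne_top).comp h1

lemma IncreasesTo.toFun_le {r : ℕ → SimpleRep m} {g : E → ℝ≥0} (h : IncreasesTo r g) (n : ℕ)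
    (s : E) : (r n).toFun s ≤ g s := (h s).1.ge_of_tendsto (h s).2 n

lemma IncreasesTo.tendsto_powNorm {r : ℕ → SimpleRep m} {g : E → ℝ≥0} (h : IncreasesTo r g)
    (hα : 0 < α) (hg : MemLPlus α m g) :
    Tendsto (fun n => (r n).powNorm α) atTop
      (𝓝 (∫⁻ s, (g s : ℝ≥0∞) ^ α ∂m).toReal) := by
  refine (ENNReal.tendsto_toReal hg.2.ne).comp ?_
  refine lintegral_tendsto_of_tendsto_of_monotone
    (fun n => ((r n).measurable_toFun.coe_nnreal_ennreal.pow_const α).aemeasurable)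
    (ae_of_all _ fun s => ?_) (ae_of_all _ fun s => ?_)
  · intro n k hnk
    exact ENNReal.rpow_le_rpow (ENNReal.coe_le_coe.2 ((h s).1 hnk)) hα.le
  · exact (ENNReal.tendsto_coe.2 (h s).2).ennrpow_const α

lemma IncreasesTo.powNorm_le {r : ℕ → SimpleRep m} {g : E → ℝ≥0} (h : IncreasesTo r g)
    (hα : 0 < α) (hg : MemLPlus α m g) (n : ℕ) :
    (r n).powNorm α ≤ (∫⁻ s, (g s : ℝ≥0∞) ^ α ∂m).toReal :=
  ENNReal.toReal_mono hg.2.ne (lintegral_mono fun s =>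
    ENNReal.rpow_le_rpow (ENNReal.coe_le_coe.2 (h.toFun_le n s)) hα.le)

lemma SimpleRep.powNorm_nonneg (α : ℝ) (r : SimpleRep m) : 0 ≤ r.powNorm α :=
  ENNReal.toReal_nonneg

namespace SimpleRep

/-- Refinements are compatible with pointwise operations. -/
lemma exists_toFun_eq_map₂ (p q : SimpleRep m) {φ : ℝ≥0 → ℝ≥0 → ℝ≥0} (hφ : φ 0 0 = 0) :
    ∃ r : SimpleRep m, ∀ s, r.toFun s = φ (p.toFun s) (q.toFun s) := by
  obtain ⟨β, _, _, C, u, v, hu, hv⟩ := p.exists_common_refinement q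
  refine ⟨ofCells C fun b => φ (u b) (v b), fun s => ?_⟩
  have hr := isRefinedBy_ofCells C fun b => φ (u b) (v b)
  by_cases hs : ∃ b, s ∈ C.cell b
  · obtain ⟨b, hb⟩ := hs
    rw [hr.toFun_eq b s hb, hu.toFun_eq b s hb, hv.toFun_eq b s hb]
  · push Not at hs
    rw [hr.toFun_of_notMem hs, hu.toFun_of_notMem hs, hv.toFun_of_notMem hs, hφ]

end SimpleRep

end approximation

/-! ### Uniform tail bounds -/

section tightness

variable {d : ℕ} {f : Vec d → ℝ} {α : ℝ} {κ : Measure {x : Vec d // f x = 1}}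

/-- Coupling: with the same radius and angle, the larger scale gives the larger norm. -/
lemma implFrechet_norm_gt_le {σ τ : ℝ} (hσ : 0 ≤ σ) (h : σ ≤ τ) (K : ℝ) :
    implFrechet α κ σ {x | K < ‖x‖} ≤ implFrechet α κ τ {x | K < ‖x‖} := by
  have hm : MeasurableSet {x : Vec d | K < ‖x‖} :=
    measurableSet_lt measurable_const measurable_norm
  rw [implFrechet, implFrechet, Measure.map_apply (measurable_polar σ) hm,
    Measure.map_apply (measurable_polar τ) hm]
  refine measure_mono fun p hp => ?_
  simp only [Set.preimage_ofPred_eq, Set.mem_ofPred_eq, norm_smul, norm_mul] at hp ⊢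
  refine hp.trans_le ?_
  rw [Real.norm_of_nonneg hσ, Real.norm_of_nonneg (hσ.trans h)]
  gcongr

lemma exists_implFrechet_norm_gt_le [IsProbabilityMeasure κ] (σ : ℝ) {η : ℝ≥0∞} (hη : 0 < η) :
    ∃ K : ℝ, 0 < K ∧ implFrechet α κ σ {x | K < ‖x‖} ≤ η := by
  have h : IsTightMeasureSet {implFrechet α κ σ} := isTightMeasureSet_singleton
  rw [isTightMeasureSet_iff_tendsto_measure_norm_gt] at h
  simp only [iSup_singleton] at h
  obtain ⟨K, h1, h2⟩ := ((h.eventually (ge_mem_nhds hη)).and (eventually_gt_atTop 0)).exists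
  exact ⟨K, h2, h1⟩

end tightness

/-! ### Comparison of two simple integrals -/

section simple

variable {d : ℕ} {f : Vec d → ℝ} {α : ℝ} {κ : Measure {x : Vec d // f x = 1}}
  [IsProbabilityMeasure κ] {E : Type*} [MeasurableSpace E] {m : Measure E}
  {Ω : Type*} [MeasurableSpace Ω] {P : Measure Ω} [IsProbabilityMeasure P]
  {M : Set E → Ω → Vec d}

namespace IsImplicitFrechetSupMeasure

/-- The integrals of simple functions `p ≤ q` of nearly equal norms are, with high probability,
nearly equal multiples of each other. -/
lemma measure_not_exists_smul_le (hM : IsImplicitFrechetSupMeasure f α κ m P M)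
    (hf : IsLossFunction f) (hα : 0 < α) {p q : SimpleRep m} (hpq : ∀ s, p.toFun s ≤ q.toFun s)
    {δ η : ℝ} (hδ : 0 < δ) (hδ1 : δ < 1)
    (h : (1 - η * (1 - (1 - δ) ^ α)) * q.powNorm α ≤ p.powNorm α) :
    P {ω | ¬ ∃ ρ : ℝ, 1 - δ ≤ ρ ∧ ρ ≤ 1 ∧ p.integral f M ω = ρ • q.integral f M ω}
      ≤ ENNReal.ofReal η := by
  classical
  obtain ⟨β, _, _, C, u₀, w, hu₀, hw⟩ := p.exists_common_refinement q
  -- `p ≤ q` compares values only on nonempty cells. Taking the minimum with `w` enforces `u ≤ w` on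
  -- the empty ones too.
  obtain ⟨u, hu, huw⟩ : ∃ u : β → ℝ≥0, p.IsRefinedBy C u ∧ ∀ b, u b ≤ w b := by
    refine ⟨fun b => u₀ b ⊓ w b, ⟨hu₀.cell_eq, fun b s hs => ?_⟩, fun b => inf_le_right⟩
    have h1 := hpq s
    rw [hu₀.toFun_eq b s hs, hw.toFun_eq b s hs] at h1
    rw [hu₀.toFun_eq b s hs, inf_eq_left.2 h1]
  rw [hu.powNorm_eq hα, hw.powNorm_eq hα] at h
  have hq0 : (0 : ℝ) ≤ (1 - δ) ^ α := Real.rpow_nonneg (by linarith) _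
  have hq1 : (1 - δ) ^ α < 1 := Real.rpow_lt_one (by linarith) (by linarith) hα
  have hq : 0 < 1 - (1 - δ) ^ α := by linarith
  set u' : β → ℝ := fun b => if (1 - δ) * (w b : ℝ) ≤ u b then (u b : ℝ) else 0 with hu'
  have hu'0 : ∀ b, 0 ≤ u' b := by
    intro b
    simp only [hu']
    split_ifs
    · exact NNReal.coe_nonneg _
    · exact le_rfl
  have huw' : ∀ b, u' b ≤ w b := by
    intro b
    simp only [hu']
    split_ifs
    · exact_mod_cast huw b
    · exact NNReal.coe_nonneg _
  have hσ := C.scale_nonneg α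
  -- A Markov-type bound: a cell lost to truncation has `u < (1 - δ) w`, so its share of the norm
  -- gap is at least `1 - (1 - δ) ^ α` times its `w`-weight. Summing, the lost weight is at most `η`
  -- times the total.
  have hterm : ∀ b, ((w b : ℝ) * C.scale α b) ^ α
      - (((w b : ℝ) * C.scale α b) ^ α - ((u b : ℝ) * C.scale α b) ^ α) / (1 - (1 - δ) ^ α)
      ≤ (u' b * C.scale α b) ^ α := by
    intro b
    have hle : ((u b : ℝ) * C.scale α b) ^ α ≤ ((w b : ℝ) * C.scale α b) ^ α :=
      Real.rpow_le_rpow (mul_nonneg (NNReal.coe_nonneg _) (hσ b))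
        (mul_le_mul_of_nonneg_right (by exact_mod_cast huw b) (hσ b)) hα.le
    have hu0 := Real.rpow_nonneg (mul_nonneg (NNReal.coe_nonneg (u b)) (hσ b)) α
    simp only [hu']
    split_ifs with hb
    · rw [sub_le_comm, le_div_iff₀ hq]
      nlinarith
    · have h1 : ((u b : ℝ) * C.scale α b) ^ α
          ≤ (1 - δ) ^ α * ((w b : ℝ) * C.scale α b) ^ α := by
        rw [← Real.mul_rpow (by linarith) (mul_nonneg (NNReal.coe_nonneg _) (hσ b)), ← mul_assoc]
        exact Real.rpow_le_rpow (mul_nonneg (NNReal.coe_nonneg _) (hσ b))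
          (mul_le_mul_of_nonneg_right (not_le.1 hb).le (hσ b)) hα.le
      rw [zero_mul, Real.zero_rpow hα.ne', sub_nonpos, le_div_iff₀ hq]
      linarith
  have hsum : (1 - η) * ∑ b, ((w b : ℝ) * C.scale α b) ^ α ≤ ∑ b, (u' b * C.scale α b) ^ α := by
    refine le_trans ?_ (Finset.sum_le_sum fun b _ => hterm b)
    rw [Finset.sum_sub_distrib, ← Finset.sum_div, Finset.sum_sub_distrib, le_sub_comm,
      div_le_iff₀ hq]
    linarith
  refine le_trans (measure_mono_ae ?_) (hM.measure_not_clearWinner_cells_le hf hα C hu'0 huw' hsum)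
  filter_upwards [hM.ae_isArgmax_integral hf hα hu, hM.ae_isArgmax_integral hf hα hw]
    with ω h1 h2 h3 h4
  exact h3 (h1.exists_smul_eq hf h2 huw hδ.le h4)

/-- Both sides are argmaxima of the same weighted family. The competition bound with `η = 0`
excludes ties, so the argmax is a.s. unique. -/
lemma exists_integral_fJoin (hM : IsImplicitFrechetSupMeasure f α κ m P M)
    (hf : IsLossFunction f) (hα : 0 < α) (p q : SimpleRep m) :
    ∃ r : SimpleRep m, (∀ s, r.toFun s = p.toFun s ⊔ q.toFun s) ∧
      r.integral f M =ᵐ[P] fun ω => fJoin f (p.integral f M ω) (q.integral f M ω) := by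
  obtain ⟨β, _, _, C, u, v, hu, hv⟩ := p.exists_common_refinement q
  have hr := SimpleRep.isRefinedBy_ofCells C fun b => u b ⊔ v b
  refine ⟨SimpleRep.ofCells C fun b => u b ⊔ v b, fun s => ?_, ?_⟩
  · by_cases hs : ∃ b, s ∈ C.cell b
    · obtain ⟨b, hb⟩ := hs
      rw [hr.toFun_eq b s hb, hu.toFun_eq b s hb, hv.toFun_eq b s hb]
    · push Not at hs
      rw [hr.toFun_of_notMem hs, hu.toFun_of_notMem hs, hv.toFun_of_notMem hs, sup_idem]
  · have hC : ∀ᵐ ω ∂P, ClearWinner (fun b => ((u b ⊔ v b : ℝ≥0) : ℝ))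
        (fun b => ((u b ⊔ v b : ℝ≥0) : ℝ)) (fun b => f (M (C.cell b) ω)) := by
      rw [ae_iff]
      refine le_antisymm ?_ zero_le
      refine (hM.measure_not_clearWinner_cells_le hf hα C (η := 0)
        (fun b => NNReal.coe_nonneg _) (fun b => le_rfl) ?_).trans_eq ENNReal.ofReal_zero
      rw [sub_zero, one_mul]
    filter_upwards [hM.ae_isArgmax_integral hf hα hu, hM.ae_isArgmax_integral hf hα hv,
      hM.ae_isArgmax_integral hf hα hr, hC] with ω h1 h2 h3 h4
    exact h3.eq_of_clearWinner hf (h1.fJoin hf h2) h4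

/-- Integrals of simple functions with nearly equal losses point, with high probability, in the
same direction. -/
lemma measure_not_smul_eq_le (hM : IsImplicitFrechetSupMeasure f α κ m P M)
    (hf : IsLossFunction f) (hα : 0 < α) (p q : SimpleRep m) {δ : ℝ} (hδ : 0 ≤ δ) (hδ1 : δ ≤ 1) :
    P {ω | (1 - δ) * max (f (p.integral f M ω)) (f (q.integral f M ω)) < f (p.integral f M ω) ∧
        (1 - δ) * max (f (p.integral f M ω)) (f (q.integral f M ω)) < f (q.integral f M ω) ∧
        f (q.integral f M ω) • p.integral f M ω ≠ f (p.integral f M ω) • q.integral f M ω}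
      ≤ ENNReal.ofReal (1 - (1 - δ) ^ α) := by
  obtain ⟨β, _, _, C, u, v, hu, hv⟩ := p.exists_common_refinement q
  have hδ' : 0 ≤ 1 - δ := by linarith
  have hw : ∀ b, (0 : ℝ) ≤ ((u b ⊔ v b : ℝ≥0) : ℝ) := fun b => NNReal.coe_nonneg _
  refine le_trans (measure_mono_ae ?_) (hM.measure_not_clearWinner_cells_le hf hα C
    (u := fun b => (1 - δ) * ((u b ⊔ v b : ℝ≥0) : ℝ)) (w := fun b => ((u b ⊔ v b : ℝ≥0) : ℝ))
    (fun b => mul_nonneg hδ' (hw b))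
    (fun b => mul_le_of_le_one_left (hw b) (by linarith)) ?_)
  · filter_upwards [hM.ae_isArgmax_integral hf hα hu, hM.ae_isArgmax_integral hf hα hv]
      with ω h1 h2 ⟨h3, h4, h5⟩ h6
    have h7 := h1.le_or_le_or_smul_eq hf h2 (h1.fJoin hf h2) h6
    rw [apply_fJoin f] at h7
    rcases h7 with h7 | h7 | h7
    · exact absurd h3 (not_lt.2 h7)
    · exact absurd h4 (not_lt.2 h7)
    · exact h5 h7
  · rw [sub_sub_cancel, Finset.mul_sum]
    refine Finset.sum_le_sum fun b _ => le_of_eq ?_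
    rw [mul_assoc, Real.mul_rpow hδ' (mul_nonneg (hw b) (C.scale_nonneg α b))]

/-- With high probability the integrals differ by a factor in `[1 - δ, 1]`, and the larger one is
bounded by a `K` depending only on `S`. The bound is uniform in `p` and `q`, as the Cauchy argument
requires. -/
lemma exists_measure_dist_le (hM : IsImplicitFrechetSupMeasure f α κ m P M)
    (hf : IsLossFunction f) (hα : 0 < α) {S : ℝ} {ε : ℝ} (hε : 0 < ε)
    {η : ℝ≥0∞} (hη : 0 < η) :
    ∃ c : ℝ, 0 ≤ c ∧ c < 1 ∧ ∀ p q : SimpleRep m, (∀ s, p.toFun s ≤ q.toFun s) →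
      q.powNorm α ≤ S → c * S ≤ p.powNorm α →
      P {ω | ε ≤ dist (p.integral f M ω) (q.integral f M ω)} ≤ η := by
  have hη2 : 0 < η / 2 := ENNReal.half_pos hη.ne'
  obtain ⟨K, hK, hKη⟩ := exists_implFrechet_norm_gt_le (α := α) (κ := κ) (S ^ (1 / α)) hη2
  -- `η` may be infinite; `e` is a finite positive substitute, kept below `1` so that the constant
  -- `c` is nonnegative.
  obtain ⟨e, he0, he⟩ := ENNReal.lt_iff_exists_nnreal_btwn.1 (lt_min hη2 one_pos)
  have he0' : (0 : ℝ) < e := by exact_mod_cast he0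
  have he1 : (e : ℝ) ≤ 1 := by exact_mod_cast (he.trans_le (min_le_right _ _)).le
  have heη : ENNReal.ofReal e ≤ η / 2 := by
    rw [ENNReal.ofReal_coe_nnreal]
    exact (he.trans_le (min_le_left _ _)).le
  set δ := min (1 / 2) (ε / (2 * K)) with hδ
  have hδ0 : 0 < δ := by positivity
  have hδ1 : δ < 1 := (min_le_left _ _).trans_lt (by norm_num)
  have hδK : δ * K < ε := by
    have h1 : δ * K ≤ ε / (2 * K) * K := mul_le_mul_of_nonneg_right (min_le_right _ _) hK.le
    have h2 : ε / (2 * K) * K = ε / 2 := by field_simp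
    linarith
  have hq0 : (0 : ℝ) < (1 - δ) ^ α := Real.rpow_pos_of_pos (by linarith) _
  have hq1 : (1 - δ) ^ α < 1 := Real.rpow_lt_one (by linarith) (by linarith) hα
  have hc0 : 0 ≤ 1 - e * (1 - (1 - δ) ^ α) := by nlinarith
  refine ⟨1 - e * (1 - (1 - δ) ^ α), hc0, by nlinarith, fun p q hpq hqS hpS => ?_⟩
  have hA := hM.measure_not_exists_smul_le hf hα hpq hδ0 hδ1 (η := e)
    ((mul_le_mul_of_nonneg_left hqS hc0).trans hpS)
  have hB : P {ω | K < ‖q.integral f M ω‖} ≤ η / 2 := by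
    have hm : MeasurableSet {x : Vec d | K < ‖x‖} :=
      measurableSet_lt measurable_const measurable_norm
    have h1 := q.powNorm_nonneg α
    calc P {ω | K < ‖q.integral f M ω‖} = P.map (q.integral f M) {x | K < ‖x‖} :=
          (Measure.map_apply (hM.measurable_integral hf q) hm).symm
      _ = implFrechet α κ (q.powNorm α ^ (1 / α)) {x | K < ‖x‖} := by rw [hM.map_integral hf hα q]
      _ ≤ implFrechet α κ (S ^ (1 / α)) {x | K < ‖x‖} :=
          implFrechet_norm_gt_le (by positivity)
            (Real.rpow_le_rpow h1 hqS (by positivity)) K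
      _ ≤ η / 2 := hKη
  calc P {ω | ε ≤ dist (p.integral f M ω) (q.integral f M ω)}
      ≤ P ({ω | ¬ ∃ ρ : ℝ, 1 - δ ≤ ρ ∧ ρ ≤ 1 ∧ p.integral f M ω = ρ • q.integral f M ω} ∪
          {ω | K < ‖q.integral f M ω‖}) := by
        refine measure_mono fun ω hω => ?_
        by_contra hcon
        simp only [Set.mem_union, Set.mem_ofPred_eq, not_or, not_not, not_lt] at hcon hω
        obtain ⟨⟨ρ, h1, h2, h3⟩, h4⟩ := hcon
        have h5 : ρ • q.integral f M ω - q.integral f M ω = (ρ - 1) • q.integral f M ω := by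
          rw [sub_smul, one_smul]
        rw [h3, dist_eq_norm, h5, norm_smul, Real.norm_of_nonpos (by linarith)] at hω
        have h6 : -(ρ - 1) * ‖q.integral f M ω‖ ≤ δ * K :=
          mul_le_mul (by linarith) h4 (norm_nonneg _) hδ0.le
        linarith
    _ ≤ _ := measure_union_le _ _
    _ ≤ η / 2 + η / 2 := add_le_add (hA.trans heη) hB
    _ = η := ENNReal.add_halves η

end IsImplicitFrechetSupMeasure

end simple

/-! ### Passage to the limit -/

/-- Fatou's lemma for events, by continuity from below along the tails `⋂ n ≥ N, A n`. -/
lemma measure_eventually_le {Ω : Type*} [MeasurableSpace Ω] {P : Measure Ω}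
    {A : ℕ → Set Ω} {c : ℝ≥0∞}
    (hA : ∀ n, P (A n) ≤ c) :
    P {ω | ∀ᶠ n in atTop, ω ∈ A n} ≤ c := by
  have e : {ω | ∀ᶠ n in atTop, ω ∈ A n} = ⋃ N, ⋂ n ≥ N, A n := by
    ext ω
    simp [eventually_atTop]
  have hmono : Monotone fun N => ⋂ n ≥ N, A n := fun N N' h =>
    Set.biInter_mono (fun n (hn : N' ≤ n) => h.trans hn) fun _ _ => subset_rfl
  rw [e, hmono.measure_iUnion]
  exact iSup_le fun N => (measure_mono (Set.biInter_subset_of_mem (le_refl N))).trans (hA N)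

section limits

variable {d : ℕ} {f : Vec d → ℝ} {α : ℝ} {κ : Measure {x : Vec d // f x = 1}}
  [IsProbabilityMeasure κ] {E : Type*} [MeasurableSpace E] {m : Measure E}
  {Ω : Type*} [MeasurableSpace Ω] {P : Measure Ω} [IsProbabilityMeasure P]
  {M : Set E → Ω → Vec d} {g h : E → ℝ≥0}

lemma eventually_mul_le_of_tendsto {x : ℕ → ℝ} {S c : ℝ} (hS : 0 ≤ S) (hc : c < 1)
    (hx0 : ∀ n, 0 ≤ x n) (hx : Tendsto x atTop (𝓝 S)) : ∀ᶠ n in atTop, c * S ≤ x n := by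
  rcases hS.eq_or_lt with rfl | hS
  · simp [hx0]
  · exact hx.eventually (le_mem_nhds (by nlinarith))

lemma IncreasesTo.map₂ {p q r : ℕ → SimpleRep m} (hp : IncreasesTo p g) (hq : IncreasesTo q h)
    {φ : ℝ≥0 → ℝ≥0 → ℝ≥0} (hφ : Continuous fun x : ℝ≥0 × ℝ≥0 => φ x.1 x.2)
    (hmono : ∀ a b c d, a ≤ b → c ≤ d → φ a c ≤ φ b d)
    (hr : ∀ n s, (r n).toFun s = φ ((p n).toFun s) ((q n).toFun s)) :
    IncreasesTo r fun s => φ (g s) (h s) := by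
  intro s
  simp only [hr]
  exact ⟨fun n k hnk => hmono _ _ _ _ ((hp s).1 hnk) ((hq s).1 hnk),
    (hφ.tendsto (g s, h s)).comp ((hp s).2.prodMk_nhds (hq s).2)⟩

namespace IsImplicitFrechetSupMeasure

lemma tendsto_measure_dist (hM : IsImplicitFrechetSupMeasure f α κ m P M)
    (hf : IsLossFunction f) (hα : 0 < α) (hg : MemLPlus α m g) {p q : ℕ → SimpleRep m}
    (hp : IncreasesTo p g) (hq : IncreasesTo q g) (hpq : ∀ n s, (p n).toFun s ≤ (q n).toFun s)
    {ε : ℝ} (hε : 0 < ε) :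
    Tendsto (fun n => P {ω | ε ≤ dist ((p n).integral f M ω) ((q n).integral f M ω)}) atTop
      (𝓝 0) := by
  rw [ENNReal.tendsto_nhds_zero]
  intro η hη
  obtain ⟨c, _, hc1, hc⟩ := hM.exists_measure_dist_le hf hα
    (S := (∫⁻ s, (g s : ℝ≥0∞) ^ α ∂m).toReal) hε hη
  filter_upwards [eventually_mul_le_of_tendsto ENNReal.toReal_nonneg hc1
    (fun n => (p n).powNorm_nonneg α) (hp.tendsto_powNorm hα hg)] with n hn
  exact hc _ _ (hpq n) (hq.powNorm_le hα hg n) hn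

lemma exists_tendstoInMeasure (hM : IsImplicitFrechetSupMeasure f α κ m P M)
    (hf : IsLossFunction f) (hα : 0 < α) (hg : MemLPlus α m g) {r : ℕ → SimpleRep m}
    (hr : IncreasesTo r g) :
    ∃ Y : Ω → Vec d, Measurable Y ∧ TendstoInMeasure P (fun n => (r n).integral f M) atTop Y := by
  refine exists_tendstoInMeasure_of_cauchy (fun n => hM.measurable_integral hf (r n))
    fun ε hε η hη => ?_
  obtain ⟨c, _, hc1, hc⟩ := hM.exists_measure_dist_le hf hα
    (S := (∫⁻ s, (g s : ℝ≥0∞) ^ α ∂m).toReal) hε hη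
  obtain ⟨N, hN⟩ := eventually_atTop.1 (eventually_mul_le_of_tendsto ENNReal.toReal_nonneg hc1
    (fun n => (r n).powNorm_nonneg α) (hr.tendsto_powNorm hα hg))
  exact ⟨N, fun n hn k hk => hc _ _ (fun s => (hr s).1 hk) (hr.powNorm_le hα hg k) (hN n hn)⟩

/-- The limit does not depend on the approximating sequence. -/
lemma tendstoInMeasure_of_increasesTo (hM : IsImplicitFrechetSupMeasure f α κ m P M)
    (hf : IsLossFunction f) (hα : 0 < α) (hg : MemLPlus α m g) {r r' : ℕ → SimpleRep m}
    (hr : IncreasesTo r g) (hr' : IncreasesTo r' g) {Y : Ω → Vec d}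
    (hY : TendstoInMeasure P (fun n => (r n).integral f M) atTop Y) :
    TendstoInMeasure P (fun n => (r' n).integral f M) atTop Y := by
  -- The pointwise minima also increase to `g` and lie below both sequences, so each sequence can be
  -- compared with them.
  choose p hp using fun n => (r n).exists_toFun_eq_map₂ (r' n) (φ := (· ⊓ ·)) (by simp)
  have hpg : IncreasesTo p g := by
    have := hr.map₂ hr' (φ := (· ⊓ ·)) continuous_inf (fun a b c d h1 h2 => inf_le_inf h1 h2) hp
    simpa using this
  rw [tendstoInMeasure_iff_dist] at hY ⊢
  intro ε hε
  have hε3 : 0 < ε / 3 := by positivity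
  have h1 := hM.tendsto_measure_dist hf hα hg hpg hr
    (fun n s => by rw [hp]; exact inf_le_left) hε3
  have h2 := hM.tendsto_measure_dist hf hα hg hpg hr'
    (fun n s => by rw [hp]; exact inf_le_right) hε3
  have h3 := (h2.add h1).add (hY _ hε3)
  rw [add_zero, add_zero] at h3
  refine tendsto_of_tendsto_of_tendsto_of_le_of_le tendsto_const_nhds h3 (fun _ => zero_le)
    fun n => ?_
  refine le_trans (measure_mono fun ω hω => ?_)
    ((measure_union_le _ _).trans (add_le_add (measure_union_le _ _) le_rfl))
  by_contra hcon
  simp only [Set.mem_union, Set.mem_ofPred_eq, not_or, not_le] at hcon hω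
  have t1 := dist_triangle ((r' n).integral f M ω) ((p n).integral f M ω) (Y ω)
  have t2 := dist_triangle ((p n).integral f M ω) ((r n).integral f M ω) (Y ω)
  rw [dist_comm ((r' n).integral f M ω) ((p n).integral f M ω)] at t1
  linarith [hcon.1.1, hcon.1.2, hcon.2]

lemma isIntegral_integral (hM : IsImplicitFrechetSupMeasure f α κ m P M)
    (hf : IsLossFunction f) (hα : 0 < α) (hg : MemLPlus α m g) :
    IsIntegral f m P M g (integral f m P M g) := by
  have hex : ∃ Y, IsIntegral f m P M g Y := by
    obtain ⟨r, hr⟩ := hg.exists_increasesTo hα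
    obtain ⟨Y, hY, hrY⟩ := hM.exists_tendstoInMeasure hf hα hg hr
    exact ⟨Y, hY, r, hr, hrY⟩
  rw [integral, dif_pos hex]
  exact hex.choose_spec

lemma tendstoInMeasure_integral (hM : IsImplicitFrechetSupMeasure f α κ m P M)
    (hf : IsLossFunction f) (hα : 0 < α) (hg : MemLPlus α m g) {r : ℕ → SimpleRep m}
    (hr : IncreasesTo r g) :
    TendstoInMeasure P (fun n => (r n).integral f M) atTop (integral f m P M g) := by
  obtain ⟨_, r', hr', hY⟩ := hM.isIntegral_integral hf hα hg
  exact hM.tendstoInMeasure_of_increasesTo hf hα hg hr' hr hY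

lemma map_integral_eq (hM : IsImplicitFrechetSupMeasure f α κ m P M)
    (hf : IsLossFunction f) (hα : 0 < α) (hg : MemLPlus α m g) :
    P.map (integral f m P M g) = implFrechet α κ (normLPlus α m g) := by
  obtain ⟨r, hr⟩ := hg.exists_increasesTo hα
  have h1 := (hM.tendstoInMeasure_integral hf hα hg hr).tendstoInDistribution
    fun n => (hM.measurable_integral hf (r n)).aemeasurable
  have hσ : Tendsto (fun n => (r n).powNorm α ^ (1 / α)) atTop (𝓝 (normLPlus α m g)) :=
    (hr.tendsto_powNorm hα hg).rpow_const (Or.inr (by positivity))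
  -- The laws of the approximants are realised with one pair of radius and angle. Convergence of the
  -- scales then gives pointwise convergence.
  have h2 : TendstoInDistribution (fun n (q : ℝ × {x : Vec d // f x = 1}) =>
      ((r n).powNorm α ^ (1 / α) * q.1) • (q.2 : Vec d)) atTop
      (fun q => (normLPlus α m g * q.1) • (q.2 : Vec d))
      (fun _ => (frechet α).prod κ) ((frechet α).prod κ) :=
    tendstoInDistribution_of_ae_tendsto (fun n => (measurable_polar _).aemeasurable)
      (measurable_polar _).aemeasurable
      (ae_of_all _ fun q => (hσ.mul_const q.1).smul_const (q.2 : Vec d))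
  have h3 : ∀ n, P.map ((r n).integral f M) = ((frechet α).prod κ).map
      fun q => ((r n).powNorm α ^ (1 / α) * q.1) • (q.2 : Vec d) :=
    fun n => hM.map_integral hf hα (r n)
  refine tendstoInDistribution_unique (fun n => (r n).integral f M) h1
    ⟨h1.forall_aemeasurable, h2.aemeasurable_limit,
      h2.tendsto.congr fun n => Subtype.ext (h3 n).symm⟩

lemma smul_integral_ae_eq (hM : IsImplicitFrechetSupMeasure f α κ m P M)
    (hf : IsLossFunction f) (hα : 0 < α) (hg : MemLPlus α m g) (a : ℝ≥0)
    (hag : MemLPlus α m fun s => a * g s) :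
    (fun ω => (a : ℝ) • integral f m P M g ω) =ᵐ[P] integral f m P M fun s => a * g s := by
  obtain ⟨r, hr⟩ := hg.exists_increasesTo hα
  let r' : ℕ → SimpleRep m := fun n => { r n with coef := fun j => a * (r n).coef j }
  have hr't : ∀ n s, (r' n).toFun s = a * (r n).toFun s := by
    intro n s
    simp only [SimpleRep.toFun, r', Finset.mul_sum]
    refine Finset.sum_congr rfl fun j _ => ?_
    by_cases hs : s ∈ (r n).cell j <;> simp [hs]
  have hr' : IncreasesTo r' fun s => a * g s :=
    hr.map₂ hr (φ := fun x _ => a * x) (by fun_prop) (fun _ _ _ _ h _ => mul_le_mul_right h a) hr't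
  have hint : ∀ n ω, (r' n).integral f M ω = (a : ℝ) • (r n).integral f M ω := by
    intro n ω
    rw [SimpleRep.integral, SimpleRep.integral, ← fMax_smul hf (NNReal.coe_nonneg a)]
    simp only [r', NNReal.coe_mul, mul_smul]
  obtain ⟨ns, _, hns⟩ := (hM.tendstoInMeasure_integral hf hα hg hr).exists_seq_tendsto_ae
  have h1 : TendstoInMeasure P (fun n => (r' (ns n)).integral f M) atTop
      fun ω => (a : ℝ) • integral f m P M g ω := by
    refine tendstoInMeasure_of_tendsto_ae
      (fun n => (hM.measurable_integral hf _).aestronglyMeasurable) ?_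
    filter_upwards [hns] with ω hω
    simp only [hint]
    exact hω.const_smul _
  have h2 := (hM.tendstoInMeasure_integral hf hα hag hr').comp
    (StrictMono.tendsto_atTop ‹StrictMono ns›)
  exact tendstoInMeasure_ae_unique h1 h2

end IsImplicitFrechetSupMeasure

/-- Unequal losses fix the winner eventually. If the limits agree, the choice does not matter. -/
lemma tendsto_fJoin_of_ne_or_eq (hf : IsLossFunction f) {x y : ℕ → Vec d} {a b : Vec d}
    (hx : Tendsto x atTop (𝓝 a)) (hy : Tendsto y atTop (𝓝 b)) (hab : f a ≠ f b ∨ a = b) :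
    Tendsto (fun n => fJoin f (x n) (y n)) atTop (𝓝 (fJoin f a b)) := by
  have hfx := (hf.continuous.tendsto _).comp hx
  have hfy := (hf.continuous.tendsto _).comp hy
  rcases hab with hab | rfl
  · rcases lt_or_gt_of_ne hab with h | h
    · have : fJoin f a b = b := if_neg (not_le.2 h)
      rw [this]
      refine hy.congr' ?_
      filter_upwards [hfx.eventually_lt hfy h] with n hn
      exact (if_neg (not_le.2 hn)).symm
    · have : fJoin f a b = a := if_pos h.le
      rw [this]
      refine hx.congr' ?_
      filter_upwards [hfy.eventually_lt hfx h] with n hn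
      exact (if_pos hn.le).symm
  · have : fJoin f a a = a := if_pos le_rfl
    rw [this]
    exact Tendsto.if' hx hy

namespace IsImplicitFrechetSupMeasure

/-- Almost surely, two limits of integrals with the same loss coincide. -/
lemma ae_apply_ne_or_eq (hM : IsImplicitFrechetSupMeasure f α κ m P M)
    (hf : IsLossFunction f) (hα : 0 < α) {p q : ℕ → SimpleRep m} {X Y : Ω → Vec d}
    (hX : ∀ᵐ ω ∂P, Tendsto (fun n => (p n).integral f M ω) atTop (𝓝 (X ω)))
    (hY : ∀ᵐ ω ∂P, Tendsto (fun n => (q n).integral f M ω) atTop (𝓝 (Y ω))) :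
    ∀ᵐ ω ∂P, f (X ω) ≠ f (Y ω) ∨ X ω = Y ω := by
  have key : ∀ δ : ℝ, 0 < δ → δ < 1 →
      P {ω | ¬ (f (X ω) ≠ f (Y ω) ∨ X ω = Y ω)} ≤ ENNReal.ofReal (1 - (1 - δ) ^ α) := by
    intro δ hδ hδ1
    refine le_trans (measure_mono_ae ?_) (measure_eventually_le fun n =>
      hM.measure_not_smul_eq_le hf hα (p n) (q n) hδ.le hδ1.le)
    filter_upwards [hX, hY] with ω h1 h2 h3
    obtain ⟨h3, h4⟩ := not_or.1 h3
    rw [not_not] at h3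
    have hpos : 0 < f (Y ω) := by
      refine lt_of_le_of_ne (hf.nonneg _) fun h0 => h4 ?_
      rw [← h0] at h3
      rw [(hf.eq_zero_iff _).1 h3, (hf.eq_zero_iff _).1 h0.symm]
    have hfx := (hf.continuous.tendsto _).comp h1
    have hfy := (hf.continuous.tendsto _).comp h2
    have hmax := (hfx.max hfy).const_mul (1 - δ)
    rw [h3, max_self] at hmax
    rw [h3] at hfx
    have hlt : (1 - δ) * f (Y ω) < f (Y ω) := by nlinarith
    have hne : f (Y ω) • X ω ≠ f (Y ω) • Y ω := fun h => h4 (smul_right_injective _ hpos.ne' h)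
    -- If the limits have equal positive loss but differ, the approximants eventually have nearly
    -- equal losses and are not parallel. The probability of this is bounded for each `n`, and the
    -- bound vanishes as `δ → 0`.
    filter_upwards [hmax.eventually_lt hfx hlt, hmax.eventually_lt hfy hlt,
      ((hfy.smul h1).sub (hfx.smul h2)).eventually_ne (sub_ne_zero.2 hne)] with n h5 h6 h7
    exact ⟨h5, h6, sub_ne_zero.1 h7⟩
  rw [ae_iff]
  refine le_antisymm ?_ zero_le
  have hlim : Tendsto (fun δ : ℝ => ENNReal.ofReal (1 - (1 - δ) ^ α)) (𝓝[>] 0) (𝓝 0) := by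
    have h1 : Tendsto (fun δ : ℝ => 1 - (1 - δ) ^ α) (𝓝 0) (𝓝 (1 - (1 - 0) ^ α)) :=
      tendsto_const_nhds.sub
        ((tendsto_const_nhds.sub tendsto_id).rpow_const (Or.inr hα.le))
    have h2 := ENNReal.tendsto_ofReal (h1.mono_left (nhdsWithin_le_nhds (s := Set.Ioi 0)))
    simpa using h2
  refine ge_of_tendsto hlim ?_
  filter_upwards [Ioo_mem_nhdsGT one_pos] with δ hδ
  exact key δ hδ.1 hδ.2

lemma fJoin_integral_ae_eq (hM : IsImplicitFrechetSupMeasure f α κ m P M)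
    (hf : IsLossFunction f) (hα : 0 < α) (hg : MemLPlus α m g) (hh : MemLPlus α m h)
    (hgh : MemLPlus α m fun s => g s ⊔ h s) :
    (fun ω => fJoin f (integral f m P M g ω) (integral f m P M h ω))
      =ᵐ[P] integral f m P M fun s => g s ⊔ h s := by
  obtain ⟨p, hp⟩ := hg.exists_increasesTo hα
  obtain ⟨q, hq⟩ := hh.exists_increasesTo hα
  choose r hr1 hr2 using fun n => hM.exists_integral_fJoin hf hα (p n) (q n)
  have hr : IncreasesTo r fun s => g s ⊔ h s :=
    hp.map₂ hq (φ := (· ⊔ ·)) continuous_sup (fun a b c d h1 h2 => sup_le_sup h1 h2) hr1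
  obtain ⟨ns, hns, h1⟩ := (hM.tendstoInMeasure_integral hf hα hg hp).exists_seq_tendsto_ae
  -- The second subsequence is extracted from the first, so both integrals converge a.s. along `ns ∘
  -- ns'`.
  obtain ⟨ns', hns', h2⟩ := ((hM.tendstoInMeasure_integral hf hα hh hq).comp
    hns.tendsto_atTop).exists_seq_tendsto_ae
  have h1' : ∀ᵐ ω ∂P, Tendsto (fun n => (p (ns (ns' n))).integral f M ω) atTop
      (𝓝 (integral f m P M g ω)) := by
    filter_upwards [h1] with ω hω using hω.comp hns'.tendsto_atTop
  have h3 := hM.ae_apply_ne_or_eq hf hα h1' h2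
  have h4 : TendstoInMeasure P (fun n => (r (ns (ns' n))).integral f M) atTop
      fun ω => fJoin f (integral f m P M g ω) (integral f m P M h ω) := by
    refine tendstoInMeasure_of_tendsto_ae
      (fun n => (hM.measurable_integral hf _).aestronglyMeasurable) ?_
    filter_upwards [h1', h2, h3, ae_all_iff.2 hr2] with ω a1 a2 a3 a4
    simp only [a4]
    exact tendsto_fJoin_of_ne_or_eq hf a1 a2 a3
  have h5 := (hM.tendstoInMeasure_integral hf hα hgh hr).comp
    (hns.tendsto_atTop.comp hns'.tendsto_atTop)
  exact tendstoInMeasure_ae_unique h4 h5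

end IsImplicitFrechetSupMeasure

lemma MemLPlus.const_mul (hα : 0 < α) (hg : MemLPlus α m g) (a : ℝ≥0) :
    MemLPlus α m fun s => a * g s := by
  refine ⟨hg.1.const_mul a, ?_⟩
  have e : ∀ s, ((a * g s : ℝ≥0) : ℝ≥0∞) ^ α = (a : ℝ≥0∞) ^ α * (g s : ℝ≥0∞) ^ α := by
    intro s
    rw [ENNReal.coe_mul, ENNReal.mul_rpow_of_nonneg _ _ hα.le]
  simp_rw [e]
  rw [lintegral_const_mul _ (hg.1.coe_nnreal_ennreal.pow_const α)]
  exact ENNReal.mul_lt_top (ENNReal.rpow_lt_top_of_nonneg hα.le ENNReal.coe_ne_top) hg.2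

lemma MemLPlus.sup (hg : MemLPlus α m g) (hh : MemLPlus α m h) :
    MemLPlus α m fun s => g s ⊔ h s := by
  refine ⟨hg.1.sup hh.1, ?_⟩
  refine (lintegral_mono fun s => ?_).trans_lt ((lintegral_add_left
    (hg.1.coe_nnreal_ennreal.pow_const α) fun s => (h s : ℝ≥0∞) ^ α).trans_lt
      (ENNReal.add_lt_top.2 ⟨hg.2, hh.2⟩))
  rcases le_total (g s) (h s) with hs | hs
  · simp only [sup_eq_right.2 hs]
    exact le_add_self
  · simp only [sup_eq_left.2 hs]
    exact le_self_add

lemma univ_sup_castSucc {k : ℕ} (x : Fin (k + 1) → ℝ≥0) :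
    Finset.univ.sup x = (Finset.univ.sup fun j : Fin k => x j.castSucc) ⊔ x (Fin.last k) := by
  refine le_antisymm (Finset.sup_le fun j _ => ?_) (sup_le (Finset.sup_le fun j _ => ?_) ?_)
  · induction j using Fin.lastCases with
    | last => exact le_sup_right
    | cast j => exact le_sup_of_le_left (Finset.le_sup (f := fun j : Fin k => x j.castSucc)
        (Finset.mem_univ j))
  · exact Finset.le_sup (Finset.mem_univ _)
  · exact Finset.le_sup (Finset.mem_univ _)

/-- Membership and identity are proved in one induction: joining a further function requires the
partial maximum to be integrable. -/
lemma IsImplicitFrechetSupMeasure.fMax_integral_ae_eq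
    (hM : IsImplicitFrechetSupMeasure f α κ m P M) (hf : IsLossFunction f) (hα : 0 < α) (k : ℕ)
    (a : Fin (k + 1) → ℝ≥0) (G : Fin (k + 1) → E → ℝ≥0) (hG : ∀ j, MemLPlus α m (G j)) :
    MemLPlus α m (fun s => Finset.univ.sup fun j => a j * G j s) ∧
      (fun ω => fMax f k (fun j => (a j : ℝ) • integral f m P M (G j) ω))
        =ᵐ[P] integral f m P M (fun s => Finset.univ.sup fun j => a j * G j s) := by
  induction k with
  | zero =>
    have e : (fun s => Finset.univ.sup fun j => a j * G j s) = fun s => a 0 * G 0 s := by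
      ext s
      simp
    rw [e]
    exact ⟨(hG 0).const_mul hα (a 0),
      hM.smul_integral_ae_eq hf hα (hG 0) (a 0) ((hG 0).const_mul hα (a 0))⟩
  | succ k ih =>
    obtain ⟨h1, h2⟩ := ih (fun j => a j.castSucc) (fun j => G j.castSucc) fun j => hG _
    have h3 := (hG (Fin.last (k + 1))).const_mul hα (a (Fin.last (k + 1)))
    have h4 := hM.smul_integral_ae_eq hf hα (hG (Fin.last (k + 1))) (a (Fin.last (k + 1))) h3
    have h5 := h1.sup h3
    simp only [univ_sup_castSucc (k := k + 1)]
    refine ⟨h5, ?_⟩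
    filter_upwards [h2, h4, hM.fJoin_integral_ae_eq hf hα h1 h3 h5] with ω a2 a4 a5
    rw [fMax, a2, a4, a5]

end limits

end ImplicitExtremal

theorem mainTheorem4 {d : ℕ} (f : ImplicitExtremal.Vec d → ℝ)
    (hf : ImplicitExtremal.IsLossFunction f)
    (α : ℝ) (hα : 0 < α)
    (κ : Measure {x : ImplicitExtremal.Vec d // f x = 1}) [IsProbabilityMeasure κ]
    {E : Type*} [MeasurableSpace E] (m : Measure E) [SigmaFinite m]
    {Ω : Type*} [MeasurableSpace Ω] (P : Measure Ω) [IsProbabilityMeasure P]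
    (M : Set E → Ω → ImplicitExtremal.Vec d)
    (hM : ImplicitExtremal.IsImplicitFrechetSupMeasure f α κ m P M)
    {ι : Type*} [Nonempty ι] (g : ι → E → ℝ≥0)
    (hg : ∀ t, ImplicitExtremal.MemLPlus α m (g t)) :
    -- the integral is well defined on `L^α_+(m)`
    (∀ h : E → ℝ≥0, ImplicitExtremal.MemLPlus α m h →
      ImplicitExtremal.IsIntegral f m P M h (ImplicitExtremal.integral f m P M h) ∧
      ∀ r : ℕ → ImplicitExtremal.SimpleRep m, ImplicitExtremal.IncreasesTo r h →
        TendstoInMeasure P (fun n => (r n).integral f M) atTop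
          (ImplicitExtremal.integral f m P M h)) ∧
    -- the process `X(t) = I(g_t)` is `f`-implicit max-stable
    ImplicitExtremal.IsImplicitMaxStableProcess f P
      (fun t => ImplicitExtremal.integral f m P M (g t)) ∧
    -- explicit form of the finite `∨_f`-maxima and of their laws
    ∀ (k : ℕ) (a : Fin (k + 1) → ℝ≥0) (t : Fin (k + 1) → ι),
      ImplicitExtremal.MemLPlus α m (fun s => Finset.univ.sup fun j => a j * g (t j) s) ∧
      (fun ω => ImplicitExtremal.fMax f k
          (fun j => (a j : ℝ) • ImplicitExtremal.integral f m P M (g (t j)) ω))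
        =ᵐ[P] ImplicitExtremal.integral f m P M
          (fun s => Finset.univ.sup fun j => a j * g (t j) s) ∧
      ImplicitExtremal.HasImplicitFrechetLaw f α κ
        (ImplicitExtremal.normLPlus α m (fun s => Finset.univ.sup fun j => a j * g (t j) s)) P
        (ImplicitExtremal.integral f m P M
          (fun s => Finset.univ.sup fun j => a j * g (t j) s)) := by
  refine ⟨fun h hh => ⟨hM.isIntegral_integral hf hα hh, fun r hr =>
    hM.tendstoInMeasure_integral hf hα hh hr⟩, ⟨fun t =>
    (hM.isIntegral_integral hf hα (hg t)).1, fun k a t => ?_⟩, fun k a t => ?_⟩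
  · obtain ⟨h1, h2⟩ := hM.fMax_integral_ae_eq hf hα k a (fun j => g (t j)) fun j => hg (t j)
    refine ImplicitExtremal.isImplicitMaxStable_of_map_eq hf hα (κ := κ) ?_
      (σ := ImplicitExtremal.normLPlus α m fun s => Finset.univ.sup fun j => a j * g (t j) s) ?_ ?_
    · exact (ImplicitExtremal.measurable_fMax hf k).comp (measurable_pi_lambda _ fun j =>
        (hM.isIntegral_integral hf hα (hg (t j))).1.const_smul (a j : ℝ))
    · exact Real.rpow_nonneg ENNReal.toReal_nonneg _
    · rw [Measure.map_congr h2]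
      exact hM.map_integral_eq hf hα h1
  · obtain ⟨h1, h2⟩ := hM.fMax_integral_ae_eq hf hα k a (fun j => g (t j)) fun j => hg (t j)
    exact ⟨h1, h2, (ImplicitExtremal.hasImplicitFrechetLaw_iff hα).2 (hM.map_integral_eq hf hα h1)⟩
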